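/- Let $f:\mathbb R\to\mathbb C$ be $2\pi$-periodic and integrable on $[-\pi,\pi]$, with Fourier coefficients $\hat f(k)=\frac1{2\pi}\int_{-\pi}^{\pi}f(x)e^{-ikx}\,dx$ $(k\in\mathbb Z)$ and partial sums $S_n(f,x)=\sum_{k=-n}^{n}\hat f(k)e^{ikx}$; write $\|g\|=\int_{-\pi}^{\pi}|g(x)|\,dx$. For $k\ge 0$ put $\Delta\hat f(k)=\hat f(k)-\hat f(k+1)$ and $\Delta\hat f(-k)=\hat f(-k)-\hat f(-k-1)$. Suppose that (a) the balance condition $$\lim_{\lambda\to1^+}\ \limsup_{n\to\infty}\ \sum_{k=n}^{[\lambda n]}\bigl|\Delta\hat f(k)-\Delta\hat f(-k)\bigr|\log k=0$$ holds (the upper limits being taken in $[0,\infty]$), and (b) the sequence $\{\hat f(n)\}_{n\ge0}$ belongs to the class GBV. Here $\{c_n\}$ belongs to GBV if there are $\theta_1\in[0,\pi/2)$, an integer $N_0\ge1$ and a constant $M>0$ such that $c_n\in K(\theta_1):=\{0\}\cup\{z\neq0:|\arg z|\le\theta_1\}$ for all $n\ge1$, where $\arg$ takes values in $(-\pi,\pi]$,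 and $$\sum_{n=m}^{2m}|c_n-c_{n+1}|\le M\max_{m\le n<m+N_0}|c_n|\qquad\text{for all } m\ge1 .$$ Then $$\lim_{n\to\infty}\|f-S_n(f)\|=0\quad\text{if and only if}\quad\lim_{|n|\to\infty}\hat f(n)\log|n|=0,$$ where in the second limit $n$ runs through all integers, positive and negative. -/

import Mathlib

open Real Filter Topology MeasureTheory

noncomputable section

namespace L1Fourier

/-- The difference `Δ c_n = c_n - c_{n+1}` of a sequence. -/
def delta (c : ℕ → ℂ) (n : ℕ) : ℂ := c n - c (n + 1)

/-- The sector `K(θ) = {z : |arg z| ≤ θ}`; it contains `0`, since `arg 0 = 0` in Mathlib. -/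
def sector (θ : ℝ) : Set ℂ := {z | |Complex.arg z| ≤ θ}

/-- The class GBV. Membership of `c` only concerns the terms `c 1, c 2, …`;
the value `c 0` is irrelevant. -/
def GBV (c : ℕ → ℂ) : Prop :=
  (∃ θ : ℝ, 0 ≤ θ ∧ θ < π / 2 ∧ ∀ n : ℕ, 1 ≤ n → c n ∈ sector θ) ∧
  ∃ (N₀ : ℕ) (hN : 0 < N₀), ∃ M : ℝ, 0 < M ∧ ∀ m : ℕ, 1 ≤ m →
    ∑ n ∈ Finset.Icc m (2 * m), ‖delta c n‖ ≤
      M * (Finset.Ico m (m + N₀)).sup'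
        (Finset.nonempty_Ico.2 (Nat.lt_add_of_pos_right hN)) (fun n => ‖c n‖)

/-- The Fourier coefficient `(1 / 2π) ∫_{-π}^{π} f(x) e^{-ikx} dx`. -/
def fhat (f : ℝ → ℂ) (k : ℤ) : ℂ := fourierCoeffOn (neg_lt_self Real.pi_pos) f k

/-- The symmetric partial sum `S_n(f, x) = ∑_{k=-n}^{n} f̂(k) e^{ikx}`. -/
def partialSum (f : ℝ → ℂ) (n : ℕ) (x : ℝ) : ℂ :=
  ∑ k ∈ Finset.Icc (-(n : ℤ)) (n : ℤ), fhat f k * Complex.exp (Complex.I * k * x)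

/-- The norm `‖g‖ = ∫_{-π}^{π} |g(x)| dx` of `L_{2π}`. -/
def L1norm (g : ℝ → ℂ) : ℝ := ∫ x in (-π)..π, ‖g x‖

/-- The sum `∑_{k=n}^{[λn]} |Δf̂(k) - Δf̂(-k)| log k`, where `Δf̂(-k) = f̂(-k) - f̂(-k-1)` is the
difference of the sequence `j ↦ f̂(-j)`. -/
def balanceSum (f : ℝ → ℂ) (lam : ℝ) (n : ℕ) : ℝ :=
  ∑ k ∈ Finset.Icc n ⌊lam * n⌋₊,
    ‖delta (fun j : ℕ => fhat f (j : ℤ)) k - delta (fun j : ℕ => fhat f (-(j : ℤ))) k‖ *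
      Real.log k

end L1Fourier

end

/-! Write `c k`, `d k` for the coefficients at `k` and `-k`. Both implications reduce to estimates,
above and below, of the L¹ norm of the symmetric block with frequencies `n < |k| ≤ m`.

Necessity. L¹ convergence makes these blocks small. Testing a block against the bounded function `(x
- π) e^{-inx}` bounds the sum of `c k / (k - n)`, up to a contribution of the `d k` that is
negligible for `m ≤ 2n` (`norm_sum_div_le_L1norm`, `CauchyL1.eventually_norm_sum_div_le`). The
sector condition rules out cancellation, and GBV bounds a later term by earlier windows of fixed
length, so the weights `1 / (k - n)` add up to a logarithm and `c n log n → 0`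
(`GBV.eventually_norm_mul_log_le`). No such regularity is assumed of `d`. Instead, balance makes `c
- d` nearly constant on `[n, λn]` at scale `1 / log n`; the weighted sums of `c` and of `d` are both
small, hence so is `(c n - d n) log n` (`CauchyL1.eventually_norm_sub_mul_log_le`).

Sufficiency. The kernel `∑_{j ≤ k} e^{ijx}` has L¹ norm `O(log k)`, so Abel summation bounds a block
by coefficients and differences weighted with logarithms; GBV controls the differences of `c`, and
balance transfers this to `d` (`GBV.exists_L1norm_block_le`). Small blocks over `[n, λn]` give
convergence to `f` by averaging the partial sums over that range, since Fejér means contract L¹ and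
trigonometric polynomials are dense (`exists_sub_mul_L1norm_sub_partialSum_le`). -/

namespace L1Fourier

/-! ### Characters, coefficients and partial sums. -/

/-- The character `x ↦ e^{ikx}`. -/
noncomputable def expI (k : ℤ) (x : ℝ) : ℂ := Complex.exp (Complex.I * k * x)

theorem norm_expI (k : ℤ) (x : ℝ) : ‖expI k x‖ = 1 := by
  have : Complex.I * k * x = ((k * x : ℝ) : ℂ) * Complex.I := by push_cast; ring
  rw [expI, this, Complex.norm_exp_ofReal_mul_I]

theorem continuous_expI (k : ℤ) : Continuous (expI k) := by
  unfold expI; fun_prop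

theorem expI_zero (x : ℝ) : expI 0 x = 1 := by simp [expI]

theorem expI_add (j k : ℤ) (x : ℝ) : expI (j + k) x = expI j x * expI k x := by
  simp only [expI, ← Complex.exp_add]; congr 1; push_cast; ring

theorem expI_neg_right (k : ℤ) (x : ℝ) : expI k (-x) = expI (-k) x := by
  simp [expI]

theorem expI_sub_right (k : ℤ) (x y : ℝ) : expI k (x - y) = expI k x * expI (-k) y := by
  simp only [expI, ← Complex.exp_add]; congr 1; push_cast; ring

theorem expI_periodic (k : ℤ) : Function.Periodic (expI k) (2 * π) := by
  intro x
  have : Complex.I * k * ((x + 2 * π : ℝ) : ℂ)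
      = Complex.I * k * x + k * (2 * π * Complex.I) := by push_cast; ring
  rw [expI, this, Complex.exp_add, Complex.exp_int_mul_two_pi_mul_I, mul_one, expI]

theorem conj_expI (k : ℤ) (x : ℝ) : (starRingEnd ℂ) (expI k x) = expI (-k) x := by
  simp [expI, ← Complex.exp_conj]

theorem integral_expI (k : ℤ) (y : ℝ) :
    ∫ x in (-π)..π, expI k (x - y) = if k = 0 then (2 * π : ℂ) else 0 := by
  split_ifs with hk
  · subst hk
    simp only [expI_zero, intervalIntegral.integral_const]
    simp; ring
  · have hper : expI k (π - y) = expI k (-π - y) := by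
      have := expI_periodic k (-π - y)
      rw [← this]; congr 1; ring
    have hk' : (Complex.I * k : ℂ) ≠ 0 := mul_ne_zero Complex.I_ne_zero (by exact_mod_cast hk)
    rw [intervalIntegral.integral_comp_sub_right (fun x => expI k x) y]
    simp only [expI] at hper ⊢
    rw [integral_exp_mul_complex hk', hper, sub_self, zero_div]

theorem fourier_coe_eq_expI {T : ℝ} (hT : T = 2 * π) (n : ℤ) (x : ℝ) :
    fourier n (x : AddCircle T) = expI n x := by
  subst hT
  rw [fourier_coe_apply, expI]
  congr 1
  have : (π : ℂ) ≠ 0 := by exact_mod_cast Real.pi_ne_zero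
  push_cast
  field_simp

theorem fhat_eq_integral (f : ℝ → ℂ) (k : ℤ) :
    fhat f k = (2 * π : ℂ)⁻¹ * ∫ x in (-π)..π, expI (-k) x * f x := by
  rw [fhat, fourierCoeffOn_eq_integral]
  simp only [fourier_coe_eq_expI (show π - -π = 2 * π by ring), smul_eq_mul, Complex.real_smul]
  congr 1
  push_cast; ring

theorem partialSum_eq (f : ℝ → ℂ) (n : ℕ) (x : ℝ) :
    partialSum f n x = ∑ k ∈ Finset.Icc (-(n : ℤ)) (n : ℤ), fhat f k * expI k x := rfl

theorem sum_Icc_neg_succ {M : Type*} [AddCommMonoid M] (g : ℤ → M) (n : ℕ) :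
    ∑ k ∈ Finset.Icc (-((n + 1 : ℕ) : ℤ)) ((n + 1 : ℕ) : ℤ), g k =
      ∑ k ∈ Finset.Icc (-(n : ℤ)) (n : ℤ), g k + (g ((n + 1 : ℕ) : ℤ) + g (-((n + 1 : ℕ) : ℤ))) := by
  have h : Finset.Icc (-((n + 1 : ℕ) : ℤ)) ((n + 1 : ℕ) : ℤ) =
      insert ((n + 1 : ℕ) : ℤ) (insert (-((n + 1 : ℕ) : ℤ)) (Finset.Icc (-(n : ℤ)) (n : ℤ))) := by
    ext k; simp only [Finset.mem_Icc, Finset.mem_insert]; push_cast; omega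
  rw [h, Finset.sum_insert, Finset.sum_insert, ← add_assoc, add_comm]
  · simp
  · simp only [Finset.mem_insert, Finset.mem_Icc]; push_cast; omega

theorem partialSum_sub (f : ℝ → ℂ) {n m : ℕ} (h : n ≤ m) (x : ℝ) :
    partialSum f m x - partialSum f n x =
      ∑ k ∈ Finset.Ioc n m, (fhat f k * expI k x + fhat f (-k) * expI (-k) x) := by
  induction m, h using Nat.le_induction with
  | base => simp
  | succ m hm ih =>
    rw [Finset.sum_Ioc_succ_top (by omega), ← ih, partialSum_eq f (m + 1), sum_Icc_neg_succ,
      ← partialSum_eq]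
    ring

theorem continuous_partialSum (f : ℝ → ℂ) (n : ℕ) : Continuous (partialSum f n) := by
  have : partialSum f n = fun x => ∑ k ∈ Finset.Icc (-(n : ℤ)) (n : ℤ), fhat f k * expI k x := rfl
  rw [this]
  exact continuous_finsetSum _ fun k _ => continuous_const.mul (continuous_expI k)

/-! ### The L¹ norm over a period. -/

theorem L1norm_nonneg (g : ℝ → ℂ) : 0 ≤ L1norm g :=
  intervalIntegral.integral_nonneg (by linarith [Real.pi_pos]) fun _ _ => norm_nonneg _

theorem L1norm_add_le {g h : ℝ → ℂ} (hg : IntervalIntegrable g volume (-π) π)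
    (hh : IntervalIntegrable h volume (-π) π) :
    L1norm (fun x => g x + h x) ≤ L1norm g + L1norm h := by
  unfold L1norm
  rw [← intervalIntegral.integral_add hg.norm hh.norm]
  exact intervalIntegral.integral_mono_on (by linarith [Real.pi_pos]) (hg.add hh).norm
    (hg.norm.add hh.norm) fun x _ => norm_add_le _ _

theorem L1norm_neg (g : ℝ → ℂ) : L1norm (fun x => -g x) = L1norm g := by
  simp [L1norm]

theorem L1norm_sub_le {g h : ℝ → ℂ} (hg : IntervalIntegrable g volume (-π) π)
    (hh : IntervalIntegrable h volume (-π) π) :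
    L1norm (fun x => g x - h x) ≤ L1norm g + L1norm h := by
  have := L1norm_add_le hg hh.neg
  simp only [Pi.neg_apply, ← sub_eq_add_neg] at this
  refine this.trans (le_of_eq ?_)
  congr 1
  exact L1norm_neg h

theorem L1norm_const_mul (a : ℂ) (g : ℝ → ℂ) : L1norm (fun x => a * g x) = ‖a‖ * L1norm g := by
  simp [L1norm]

theorem L1norm_sum_le {ι : Type*} (s : Finset ι) {g : ι → ℝ → ℂ}
    (hg : ∀ i ∈ s, IntervalIntegrable (g i) volume (-π) π) :
    L1norm (fun x => ∑ i ∈ s, g i x) ≤ ∑ i ∈ s, L1norm (g i) := by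
  unfold L1norm
  rw [← intervalIntegral.integral_finsetSum fun i hi => (hg i hi).norm]
  have h1 : IntervalIntegrable (fun x => ∑ i ∈ s, g i x) volume (-π) π := by
    simp only [intervalIntegrable_iff] at hg ⊢
    exact integrable_finsetSum s hg
  have h2 : IntervalIntegrable (fun x => ∑ i ∈ s, ‖g i x‖) volume (-π) π := by
    simp only [intervalIntegrable_iff] at hg ⊢
    exact integrable_finsetSum s fun i hi => (hg i hi).norm
  exact intervalIntegral.integral_mono_on (by linarith [Real.pi_pos]) h1.norm h2
    fun x _ => norm_sum_le _ _

theorem L1norm_comp_neg (g : ℝ → ℂ) : L1norm (fun x => g (-x)) = L1norm g := by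
  unfold L1norm
  have := intervalIntegral.integral_comp_neg (a := -π) (b := π) (fun x => ‖g x‖)
  simpa using this

theorem L1norm_eq_of_periodic {g : ℝ → ℂ} (hg : Function.Periodic g (2 * π)) :
    L1norm g = ∫ x in (0)..(2 * π), ‖g x‖ := by
  have h : Function.Periodic (fun x => ‖g x‖) (2 * π) := fun x => by simp only [hg x]
  have := h.intervalIntegral_add_eq (-π) 0
  rw [L1norm]
  convert this using 2 <;> ring

/-! ### Lower bounds for blocks: the sawtooth test function. -/

/-- Integration by parts gives the antiderivative below; its `1 / k²` part is periodic, so only the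
jump of the sawtooth contributes. -/
theorem integral_sub_pi_mul_expI {k : ℤ} (hk : k ≠ 0) :
    ∫ x in (0)..(2 * π), ((x - π : ℝ) : ℂ) * expI k x = 2 * π / (Complex.I * k) := by
  have hk' : (k : ℂ) ≠ 0 := by exact_mod_cast hk
  have hI := Complex.I_ne_zero
  have hd : ∀ x ∈ Set.uIcc 0 (2 * π), HasDerivAt
      (fun x : ℝ => ((x - π : ℝ) : ℂ) * expI k x / (Complex.I * k) + expI k x / (k : ℂ) ^ 2)
      (((x - π : ℝ) : ℂ) * expI k x) x := by
    intro x _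
    have h1 : HasDerivAt (expI k) (expI k x * (Complex.I * k)) x := by
      have h := ((Complex.ofRealCLM.hasDerivAt (x := x)).const_mul (Complex.I * k)).cexp
      simp only [Complex.ofRealCLM_apply, Complex.ofReal_one, mul_one] at h
      exact h
    have h2 : HasDerivAt (fun x : ℝ => ((x - π : ℝ) : ℂ)) 1 x := by
      simpa using ((hasDerivAt_id x).sub_const π).ofReal_comp
    convert! ((h2.mul h1).div_const (Complex.I * k)).add (h1.div_const ((k : ℂ) ^ 2)) using 1
    field_simp
    ring_nf
    simp [Complex.I_sq]
  have hc : Continuous fun x : ℝ => ((x - π : ℝ) : ℂ) * expI k x :=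
    (by fun_prop : Continuous fun x : ℝ => ((x - π : ℝ) : ℂ)).mul (continuous_expI k)
  rw [intervalIntegral.integral_eq_sub_of_hasDerivAt hd (hc.intervalIntegrable _ _)]
  have h1 : expI k (2 * π) = 1 := by
    have := expI_periodic k 0
    rw [zero_add] at this
    rw [this]; simp [expI]
  have h0 : expI k 0 = 1 := by simp [expI]
  rw [h1, h0]
  push_cast
  field_simp
  ring

theorem periodic_sum_expI (s : Finset ℕ) (c d : ℕ → ℂ) :
    Function.Periodic (fun x => ∑ k ∈ s, (c k * expI k x + d k * expI (-k) x)) (2 * π) := by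
  intro x
  refine Finset.sum_congr rfl fun k _ => ?_
  rw [expI_periodic, expI_periodic]

theorem continuous_sum_expI (s : Finset ℕ) (c d : ℕ → ℂ) :
    Continuous (fun x => ∑ k ∈ s, (c k * expI k x + d k * expI (-k) x)) :=
  continuous_finsetSum _ fun _ _ => (continuous_const.mul (continuous_expI _)).add
    (continuous_const.mul (continuous_expI _))

/-- A Hardy type inequality, from testing against the sawtooth function. -/
theorem norm_sum_div_le_L1norm (c d : ℕ → ℂ) (n m : ℕ) :
    ‖∑ k ∈ Finset.Ioc n m, (c k / ((k : ℂ) - n) - d k / ((k : ℂ) + n))‖ ≤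
      1 / 2 * L1norm (fun x => ∑ k ∈ Finset.Ioc n m, (c k * expI k x + d k * expI (-k) x)) := by
  set P : ℝ → ℂ := fun x => ∑ k ∈ Finset.Ioc n m, (c k * expI k x + d k * expI (-k) x) with hP
  have hPc : Continuous P := continuous_sum_expI _ _ _
  have hsaw : Continuous fun x : ℝ => ((x - π : ℝ) : ℂ) := by fun_prop
  have hcont : ∀ k : ℤ, Continuous fun x : ℝ => ((x - π : ℝ) : ℂ) * expI k x := fun k =>
    hsaw.mul (continuous_expI k)
  have key : ∫ x in (0)..(2 * π), ((x - π : ℝ) : ℂ) * expI (-n) x * P x =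
      (2 * π / Complex.I) *
        ∑ k ∈ Finset.Ioc n m, (c k / ((k : ℂ) - n) - d k / ((k : ℂ) + n)) := by
    have h1 : ∀ x : ℝ, ((x - π : ℝ) : ℂ) * expI (-n) x * P x = ∑ k ∈ Finset.Ioc n m,
        (c k * (((x - π : ℝ) : ℂ) * expI (k - n) x) +
          d k * (((x - π : ℝ) : ℂ) * expI (-k - n) x)) := by
      intro x
      rw [hP, Finset.mul_sum]
      refine Finset.sum_congr rfl fun k _ => ?_
      rw [sub_eq_add_neg (k : ℤ) (n : ℤ), sub_eq_add_neg (-(k : ℤ)) (n : ℤ), expI_add, expI_add]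
      ring
    simp only [h1]
    rw [intervalIntegral.integral_finsetSum, Finset.mul_sum]
    · refine Finset.sum_congr rfl fun k hk => ?_
      rw [Finset.mem_Ioc] at hk
      rw [intervalIntegral.integral_add, intervalIntegral.integral_const_mul,
        intervalIntegral.integral_const_mul, integral_sub_pi_mul_expI (by omega),
        integral_sub_pi_mul_expI (by omega)]
      · have h3 : ((k : ℂ) - n) ≠ 0 := by
          rw [sub_ne_zero]; exact_mod_cast hk.1.ne'
        have h4 : ((k : ℂ) + n) ≠ 0 := by
          have : k + n ≠ 0 := by omega
          exact_mod_cast this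
        have h5 : (-(k : ℂ) - n) ≠ 0 := by
          intro h; apply h4; linear_combination -h
        have hI := Complex.I_ne_zero
        push_cast
        have h6 : (-(k : ℂ) - n) = -((k : ℂ) + n) := by ring
        rw [h6]
        field_simp
        ring
      · exact (continuous_const.mul (hcont _)).intervalIntegrable _ _
      · exact (continuous_const.mul (hcont _)).intervalIntegrable _ _
    · intro k _
      exact ((continuous_const.mul (hcont _)).add
        (continuous_const.mul (hcont _))).intervalIntegrable _ _
  -- The sawtooth is bounded by `π` on `[0, 2π]`; against the factor `2π` in `key` this leaves the
  -- constant `1/2`.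
  have hb : ‖∫ x in (0)..(2 * π), ((x - π : ℝ) : ℂ) * expI (-n) x * P x‖ ≤ π * L1norm P := by
    rw [L1norm_eq_of_periodic (periodic_sum_expI _ _ _), ← intervalIntegral.integral_const_mul]
    refine (intervalIntegral.norm_integral_le_integral_norm (by positivity)).trans ?_
    refine intervalIntegral.integral_mono_on (by positivity) ?_ ?_ fun x hx => ?_
    · exact ((hcont _).mul hPc).norm.intervalIntegrable _ _
    · exact (continuous_const.mul hPc.norm).intervalIntegrable _ _
    · rw [norm_mul, norm_mul, norm_expI, mul_one, Complex.norm_real]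
      refine mul_le_mul_of_nonneg_right ?_ (norm_nonneg _)
      rw [Real.norm_eq_abs, abs_le]
      constructor <;> linarith [hx.1, hx.2]
  rw [key, norm_mul] at hb
  have h7 : ‖(2 * π / Complex.I : ℂ)‖ = 2 * π := by
    simp [abs_of_pos Real.pi_pos]
  rw [h7] at hb
  have := Real.pi_pos
  have h8 : π * (2 * ‖∑ k ∈ Finset.Ioc n m, (c k / ((k : ℂ) - n) - d k / ((k : ℂ) + n))‖) ≤
    π * L1norm P := by linarith
  linarith [le_of_mul_le_mul_left h8 this]

/-- The reflection `x ↦ -x` exchanges positive and negative frequencies, so every estimate for `c`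
has a twin for `d`. -/
theorem L1norm_sum_swap (s : Finset ℕ) (c d : ℕ → ℂ) :
    L1norm (fun x => ∑ k ∈ s, (d k * expI k x + c k * expI (-k) x)) =
      L1norm (fun x => ∑ k ∈ s, (c k * expI k x + d k * expI (-k) x)) := by
  rw [← L1norm_comp_neg]
  congr 1; ext x
  refine Finset.sum_congr rfl fun k _ => ?_
  rw [expI_neg_right, expI_neg_right, neg_neg, add_comm]

/-! ### Upper bounds for blocks: the one-sided kernel and Abel summation. -/

/-- The one-sided kernel `∑_{k<n} e^{ikx}`. -/
noncomputable def expSum (n : ℕ) (x : ℝ) : ℂ := ∑ k ∈ Finset.range n, expI k x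

theorem continuous_expSum (n : ℕ) : Continuous (expSum n) :=
  continuous_finsetSum _ fun _ _ => continuous_expI _

theorem norm_expSum_le (n : ℕ) (x : ℝ) : ‖expSum n x‖ ≤ n := by
  refine (norm_sum_le _ _).trans ?_
  simp [norm_expI]

theorem norm_expSum_neg (n : ℕ) (x : ℝ) : ‖expSum n (-x)‖ = ‖expSum n x‖ := by
  rw [← Complex.norm_conj (expSum n x)]
  simp only [expSum, map_sum, conj_expI, expI_neg_right]

theorem expSum_mul_sub_one (n : ℕ) (x : ℝ) : expSum n x * (expI 1 x - 1) = expI n x - 1 := by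
  induction n with
  | zero => simp [expSum, expI_zero]
  | succ n ih =>
    rw [expSum, Finset.sum_range_succ, ← expSum, add_mul, ih]
    push_cast
    rw [expI_add]; ring

/-- The geometric sum has numerator at most `2`, and Jordan's inequality bounds the denominator `2
|sin (x/2)|` from below by `2x/π`. -/
theorem norm_expSum_le_div (n : ℕ) {x : ℝ} (hx : 0 < x) (hx' : x ≤ π) :
    ‖expSum n x‖ ≤ π / x := by
  have h1 : ‖expSum n x‖ * ‖expI 1 x - 1‖ ≤ 2 := by
    rw [← norm_mul, expSum_mul_sub_one]
    refine (norm_sub_le _ _).trans ?_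
    rw [norm_expI]; norm_num
  have h2 : 2 / π * x ≤ ‖expI 1 x - 1‖ := by
    have : expI 1 x = Complex.exp (Complex.I * x) := by simp [expI]
    rw [this, Complex.norm_exp_I_mul_ofReal_sub_one, Real.norm_eq_abs, abs_mul, abs_two]
    have := Real.mul_le_sin (x := x / 2) (by positivity) (by linarith)
    have h3 := le_abs_self (Real.sin (x / 2))
    have h4 : 2 / π * x = 2 * (2 / π * (x / 2)) := by ring
    rw [h4]; linarith
  have hpi := Real.pi_pos
  have h3 : ‖expSum n x‖ * (2 / π * x) ≤ 2 :=
    (mul_le_mul_of_nonneg_left h2 (norm_nonneg _)).trans h1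
  rw [le_div_iff₀ hx]
  have h4 : ‖expSum n x‖ * (2 / π * x) = (2 / π) * (‖expSum n x‖ * x) := by ring
  rw [h4, div_mul_eq_mul_div, div_le_iff₀ hpi] at h3
  linarith

/-- By symmetry it suffices to integrate over `[0, π]`, using the bound `n` up to `1/n` and the
bound `π/x` beyond. -/
theorem L1norm_expSum_le {n : ℕ} (hn : 1 ≤ n) :
    L1norm (expSum n) ≤ 2 * (1 + π * Real.log (π * n)) := by
  have hpi := Real.pi_gt_three
  have hn' : (1 : ℝ) ≤ n := by exact_mod_cast hn
  have hc := (continuous_expSum n).norm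
  have hinv : (n : ℝ)⁻¹ ≤ 1 := inv_le_one_of_one_le₀ hn'
  have hpos : 0 < (n : ℝ)⁻¹ := by positivity
  have hneg : ∫ x in (-π)..0, ‖expSum n x‖ = ∫ x in (0)..π, ‖expSum n x‖ := by
    have := intervalIntegral.integral_comp_neg (a := (0 : ℝ)) (b := π) (fun x => ‖expSum n x‖)
    simp only [norm_expSum_neg, neg_zero] at this
    exact this.symm
  have h1 : ∫ x in (0)..(n : ℝ)⁻¹, ‖expSum n x‖ ≤ 1 := by
    calc ∫ x in (0)..(n : ℝ)⁻¹, ‖expSum n x‖ ≤ ∫ _ in (0)..(n : ℝ)⁻¹, (n : ℝ) :=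
          intervalIntegral.integral_mono_on hpos.le (hc.intervalIntegrable _ _)
            (continuous_const.intervalIntegrable _ _) fun x _ => norm_expSum_le n x
      _ = 1 := by simp; field_simp
  have h2 : ∫ x in ((n : ℝ)⁻¹)..π, ‖expSum n x‖ ≤ π * Real.log (π * n) := by
    have hle : (n : ℝ)⁻¹ ≤ π := by linarith
    have hcd : ContinuousOn (fun x : ℝ => π / x) (Set.uIcc ((n : ℝ)⁻¹) π) := by
      refine continuousOn_const.div continuousOn_id fun x hx => ?_
      rw [Set.uIcc_of_le hle] at hx
      exact (hpos.trans_le hx.1).ne'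
    calc ∫ x in ((n : ℝ)⁻¹)..π, ‖expSum n x‖ ≤ ∫ x in ((n : ℝ)⁻¹)..π, π / x :=
          intervalIntegral.integral_mono_on hle (hc.intervalIntegrable _ _)
            hcd.intervalIntegrable fun x hx =>
              norm_expSum_le_div n (hpos.trans_le hx.1) hx.2
      _ = π * Real.log (π * n) := by
        simp only [div_eq_mul_inv, intervalIntegral.integral_const_mul]
        rw [integral_inv_of_pos hpos (by linarith), div_inv_eq_mul]
  have h3 := intervalIntegral.integral_add_adjacent_intervals
    (hc.intervalIntegrable (μ := volume) (-π) 0) (hc.intervalIntegrable 0 π)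
  have h4 := intervalIntegral.integral_add_adjacent_intervals
    (hc.intervalIntegrable (μ := volume) 0 (n : ℝ)⁻¹) (hc.intervalIntegrable (n : ℝ)⁻¹ π)
  rw [L1norm, ← h3, hneg, ← h4]
  linarith

theorem exists_L1norm_expSum_succ_le_log :
    ∃ C : ℝ, 0 < C ∧ ∀ n : ℕ, 2 ≤ n → L1norm (expSum (n + 1)) ≤ C * Real.log n := by
  have hpi := Real.pi_gt_three
  have hl2 : 0 < Real.log 2 := Real.log_pos one_lt_two
  have hlp : 0 < Real.log π := Real.log_pos (by linarith)
  -- The first summand absorbs the additive constants through `log 2 ≤ log n`; the second comes from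
  -- `n + 1 ≤ n ^ 2`.
  refine ⟨(2 + 2 * π * Real.log π) / Real.log 2 + 4 * π, by positivity, fun n hn => ?_⟩
  have hn' : (2 : ℝ) ≤ n := by exact_mod_cast hn
  have h1 := L1norm_expSum_le (n := n + 1) (by omega)
  have h2 : Real.log (π * ((n + 1 : ℕ) : ℝ)) ≤ Real.log π + 2 * Real.log n := by
    rw [Real.log_mul (by positivity) (by positivity)]
    have : Real.log ((n + 1 : ℕ) : ℝ) ≤ Real.log ((n : ℝ) ^ 2) := by
      apply Real.log_le_log (by positivity)
      push_cast; nlinarith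
    rw [Real.log_pow] at this
    push_cast at this ⊢
    linarith
  have h3 : Real.log 2 ≤ Real.log n := Real.log_le_log (by norm_num) hn'
  have h4 : 2 + 2 * π * Real.log π ≤ (2 + 2 * π * Real.log π) / Real.log 2 * Real.log n := by
    rw [div_mul_eq_mul_div, le_div_iff₀ hl2]
    exact mul_le_mul_of_nonneg_left h3 (by positivity)
  have h5 := mul_le_mul_of_nonneg_left h2 (show 0 ≤ 2 * π by positivity)
  rw [add_mul]
  linarith

theorem sum_Ioc_mul_expI (a : ℕ → ℂ) {n m : ℕ} (h : n ≤ m) (x : ℝ) :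
    ∑ k ∈ Finset.Ioc n m, a k * expI k x =
      a m * expSum (m + 1) x - a n * expSum (n + 1) x +
        ∑ k ∈ Finset.Ico n m, delta a k * expSum (k + 1) x := by
  induction m, h using Nat.le_induction with
  | base => simp
  | succ m hm ih =>
    rw [Finset.sum_Ioc_succ_top (by omega), ih, Finset.sum_Ico_succ_top hm,
      expSum, expSum, expSum, Finset.sum_range_succ _ (m + 1), delta]
    push_cast
    ring

theorem exists_L1norm_sum_Ioc_le :
    ∃ C : ℝ, 0 < C ∧ ∀ (a : ℕ → ℂ) (n m : ℕ), 2 ≤ n → n ≤ m →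
      L1norm (fun x => ∑ k ∈ Finset.Ioc n m, a k * expI k x) ≤
        C * (‖a m‖ * Real.log m + ‖a n‖ * Real.log n +
          ∑ k ∈ Finset.Ico n m, ‖delta a k‖ * Real.log k) := by
  obtain ⟨C, hC, h⟩ := exists_L1norm_expSum_succ_le_log
  refine ⟨C, hC, fun a n m hn hnm => ?_⟩
  simp only [sum_Ioc_mul_expI a hnm]
  have hi : ∀ (b : ℂ) (k : ℕ),
      IntervalIntegrable (fun x => b * expSum k x) volume (-π) π := fun b k =>
    (continuous_const.mul (continuous_expSum k)).intervalIntegrable _ _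
  have hb : ∀ (b : ℂ) (k : ℕ), 2 ≤ k →
      L1norm (fun x => b * expSum (k + 1) x) ≤ C * (‖b‖ * Real.log k) := fun b k hk => by
    rw [L1norm_const_mul]
    have := mul_le_mul_of_nonneg_left (h k hk) (norm_nonneg b)
    linarith
  have hs : IntervalIntegrable
      (fun x => ∑ k ∈ Finset.Ico n m, delta a k * expSum (k + 1) x) volume (-π) π :=
    (continuous_finsetSum _ fun k _ =>
      continuous_const.mul (continuous_expSum (k + 1))).intervalIntegrable _ _
  refine (L1norm_add_le ((hi _ _).sub (hi _ _)) hs).trans ?_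
  have h1 := L1norm_sub_le (hi (a m) (m + 1)) (hi (a n) (n + 1))
  have h2 := L1norm_sum_le (Finset.Ico n m) (g := fun k x => delta a k * expSum (k + 1) x)
    fun k _ => hi _ _
  have h3 := hb (a m) m (by omega)
  have h4 := hb (a n) n hn
  have h5 : ∑ k ∈ Finset.Ico n m, L1norm (fun x => delta a k * expSum (k + 1) x) ≤
      C * ∑ k ∈ Finset.Ico n m, ‖delta a k‖ * Real.log k := by
    rw [Finset.mul_sum]
    refine Finset.sum_le_sum fun k hk => hb _ _ ?_
    rw [Finset.mem_Ico] at hk; omega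
  rw [mul_add, mul_add]
  exact add_le_add (h1.trans (add_le_add h3 h4)) (h2.trans h5)

/-! ### The Fejér kernel and its contraction property. -/

theorem sum_Icc_expI (m : ℕ) (t : ℝ) :
    ∑ k ∈ Finset.Icc (-(m : ℤ)) m, expI k t =
      1 + ∑ l ∈ Finset.range m, (expI ((l + 1 : ℕ) : ℤ) t + expI (-((l + 1 : ℕ) : ℤ)) t) := by
  induction m with
  | zero => simp [expI_zero]
  | succ m ih => rw [sum_Icc_neg_succ, ih, Finset.sum_range_succ, add_assoc]

/-- Multiplying by `e^{imt}` reflects the frequencies `0, -1, …, -(m-1)` onto `m, …, 1`: this is the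
cross term when the square of the kernel is expanded. -/
theorem expI_mul_conj_expSum (m : ℕ) (t : ℝ) :
    expI m t * (starRingEnd ℂ) (expSum m t) = ∑ l ∈ Finset.range m, expI ((l + 1 : ℕ) : ℤ) t := by
  induction m with
  | zero => simp [expSum]
  | succ m ih =>
    have h0 : expI m t * expI (-m) t = 1 := by rw [← expI_add]; simp [expI_zero]
    have h1 : expI ((m + 1 : ℕ) : ℤ) t * (starRingEnd ℂ) (expSum (m + 1) t) =
        expI 1 t * (expI m t * (starRingEnd ℂ) (expSum m t)) + expI 1 t := by
      rw [expSum, Finset.sum_range_succ, ← expSum, map_add, conj_expI]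
      push_cast
      rw [expI_add]
      linear_combination expI 1 t * h0
    rw [h1, ih, Finset.sum_range_succ', Finset.mul_sum]
    congr 1
    · refine Finset.sum_congr rfl fun l _ => ?_
      rw [← expI_add]; congr 1; push_cast; ring

/-- The (unnormalised) Fejér kernel is a square. -/
theorem sum_sum_expI (m : ℕ) (t : ℝ) :
    ∑ j ∈ Finset.range m, ∑ k ∈ Finset.Icc (-(j : ℤ)) j, expI k t =
      ((‖expSum m t‖ ^ 2 : ℝ) : ℂ) := by
  have hsq : ∀ z : ℂ, ((‖z‖ ^ 2 : ℝ) : ℂ) = z * (starRingEnd ℂ) z := fun z => by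
    rw [Complex.mul_conj, Complex.normSq_eq_norm_sq]
  rw [hsq]
  induction m with
  | zero => simp [expSum]
  | succ m ih =>
    have h1 := expI_mul_conj_expSum m t
    have h2 := congrArg (starRingEnd ℂ) h1
    simp only [map_mul, Complex.conj_conj, map_sum, conj_expI] at h2
    have h0 : expI m t * expI (-m) t = 1 := by rw [← expI_add]; simp [expI_zero]
    have h3 : expSum (m + 1) t = expSum m t + expI m t := by
      rw [expSum, Finset.sum_range_succ, ← expSum]
    rw [Finset.sum_range_succ, ih, sum_Icc_expI, Finset.sum_add_distrib, ← h1, ← h2, h3, map_add,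
      conj_expI]
    linear_combination -h0

theorem sum_partialSum_eq_integral {h : ℝ → ℂ} (hh : IntervalIntegrable h volume (-π) π)
    (m : ℕ) (x : ℝ) :
    ∑ j ∈ Finset.range m, partialSum h j x =
      (2 * π : ℂ)⁻¹ * ∫ y in (-π)..π, ((‖expSum m (x - y)‖ ^ 2 : ℝ) : ℂ) * h y := by
  simp only [← sum_sum_expI, Finset.sum_mul]
  have hi : ∀ k : ℤ, IntervalIntegrable (fun y => expI k (x - y) * h y) volume (-π) π := fun k =>
    hh.continuousOn_mul
      ((continuous_expI k).comp (continuous_const.sub continuous_id)).continuousOn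
  rw [intervalIntegral.integral_finsetSum, Finset.mul_sum]
  · refine Finset.sum_congr rfl fun j _ => ?_
    rw [intervalIntegral.integral_finsetSum fun k _ => hi k, Finset.mul_sum, partialSum_eq]
    refine Finset.sum_congr rfl fun k _ => ?_
    rw [fhat_eq_integral, mul_assoc, ← intervalIntegral.integral_mul_const]
    congr 1
    refine intervalIntegral.integral_congr fun y _ => ?_
    simp only [expI_sub_right]; ring
  · intro j _
    have : ∀ k ∈ Finset.Icc (-(j : ℤ)) j,
      IntervalIntegrable (fun y => expI k (x - y) * h y) volume (-π) π := fun k _ => hi k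
    simp only [intervalIntegrable_iff] at this ⊢
    exact integrable_finsetSum _ this

theorem integral_norm_expSum_sq (m : ℕ) (y : ℝ) :
    ∫ x in (-π)..π, ‖expSum m (x - y)‖ ^ 2 = 2 * π * m := by
  have h : (∫ x in (-π)..π, ((‖expSum m (x - y)‖ ^ 2 : ℝ) : ℂ)) = ((2 * π * m : ℝ) : ℂ) := by
    simp only [← sum_sum_expI]
    have hi : ∀ k : ℤ, Continuous (fun x => expI k (x - y)) := fun k =>
      (continuous_expI k).comp (continuous_id.sub continuous_const)
    rw [intervalIntegral.integral_finsetSum fun j _ =>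
      (continuous_finsetSum _ fun k _ => hi k).intervalIntegrable _ _]
    have : ∀ j ∈ Finset.range m, ∫ x in (-π)..π, ∑ k ∈ Finset.Icc (-(j : ℤ)) j, expI k (x - y) =
        (2 * π : ℂ) := fun j _ => by
      rw [intervalIntegral.integral_finsetSum fun k _ => (hi k).intervalIntegrable _ _]
      rw [Finset.sum_congr rfl fun k _ => integral_expI k y]
      simp
    rw [Finset.sum_congr rfl this]
    simp; ring
  rw [intervalIntegral.integral_ofReal] at h
  exact_mod_cast h

/-- The Fejér means are contractions of `L¹`. -/
theorem L1norm_sum_partialSum_le {h : ℝ → ℂ} (hh : IntervalIntegrable h volume (-π) π) (m : ℕ) :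
    L1norm (fun x => ∑ j ∈ Finset.range m, partialSum h j x) ≤ m * L1norm h := by
  have hpi := Real.pi_pos
  have hle : -π ≤ π := by linarith
  have hK : Continuous fun p : ℝ × ℝ => ‖expSum m (p.1 - p.2)‖ ^ 2 :=
    ((continuous_expSum m).comp (continuous_fst.sub continuous_snd)).norm.pow 2
  have hh' : Integrable h (volume.restrict (Set.Ioc (-π) π)) := by
    rwa [intervalIntegrable_iff_integrableOn_Ioc_of_le hle] at hh
  -- Joint integrability for Fubini: a continuous kernel bounded by `m ^ 2` times an integrable
  -- function of `y` alone.
  have hprod : Integrable (Function.uncurry fun x y : ℝ => ‖expSum m (x - y)‖ ^ 2 * ‖h y‖)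
      ((volume.restrict (Set.Ioc (-π) π)).prod (volume.restrict (Set.Ioc (-π) π))) := by
    have h1 : Integrable (fun p : ℝ × ℝ => (1 : ℝ) * ‖h p.2‖)
        ((volume.restrict (Set.Ioc (-π) π)).prod (volume.restrict (Set.Ioc (-π) π))) :=
      (integrable_const (1 : ℝ)).mul_prod hh'.norm
    have h2 := h1.bdd_mul (c := (m : ℝ) ^ 2) (f := fun p : ℝ × ℝ => ‖expSum m (p.1 - p.2)‖ ^ 2)
      hK.aestronglyMeasurable (Eventually.of_forall fun p => by
        rw [norm_pow, norm_norm]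
        exact pow_le_pow_left₀ (norm_nonneg _) (norm_expSum_le m _) 2)
    refine h2.congr (Eventually.of_forall fun p => ?_)
    simp [Function.uncurry]
  have hpt : ∀ x, ‖∑ j ∈ Finset.range m, partialSum h j x‖ ≤
      (2 * π)⁻¹ * ∫ y in (-π)..π, ‖expSum m (x - y)‖ ^ 2 * ‖h y‖ := fun x => by
    rw [sum_partialSum_eq_integral hh, norm_mul]
    have h1 : ‖((2 * π : ℂ)⁻¹)‖ = (2 * π)⁻¹ := by simp [abs_of_pos hpi]
    rw [h1]
    refine mul_le_mul_of_nonneg_left ?_ (by positivity)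
    refine (intervalIntegral.norm_integral_le_integral_norm hle).trans (le_of_eq ?_)
    refine intervalIntegral.integral_congr fun y _ => ?_
    simp only [norm_mul, Complex.norm_real, norm_pow, norm_norm]
  have hswap : ∫ x in (-π)..π, ∫ y in (-π)..π, ‖expSum m (x - y)‖ ^ 2 * ‖h y‖ =
      2 * π * m * L1norm h := by
    simp only [intervalIntegral.integral_of_le hle]
    rw [integral_integral_swap hprod]
    simp only [← intervalIntegral.integral_of_le hle, intervalIntegral.integral_mul_const,
      integral_norm_expSum_sq, intervalIntegral.integral_const_mul, L1norm]
  have hint : IntervalIntegrable (fun x => ∫ y in (-π)..π, ‖expSum m (x - y)‖ ^ 2 * ‖h y‖)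
      volume (-π) π := by
    rw [intervalIntegrable_iff_integrableOn_Ioc_of_le hle]
    simp only [intervalIntegral.integral_of_le hle]
    exact hprod.integral_prod_left
  calc L1norm (fun x => ∑ j ∈ Finset.range m, partialSum h j x)
      ≤ ∫ x in (-π)..π, (2 * π)⁻¹ * ∫ y in (-π)..π, ‖expSum m (x - y)‖ ^ 2 * ‖h y‖ := by
        refine intervalIntegral.integral_mono_on hle ?_ (hint.const_mul _) fun x _ => hpt x
        exact (continuous_finsetSum _ fun j _ =>
          continuous_partialSum h j).norm.intervalIntegrable _ _
    _ = m * L1norm h := by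
        rw [intervalIntegral.integral_const_mul, hswap]; field_simp

/-! ### Density and the de la Vallée-Poussin averaging argument. -/

/-- Trigonometric polynomials are dense in `L¹`. -/
theorem exists_trigPoly_L1norm_sub_lt {f : ℝ → ℂ} (hf : IntervalIntegrable f volume (-π) π)
    {ε : ℝ} (hε : 0 < ε) :
    ∃ (a : ℤ → ℂ) (s : Finset ℤ), L1norm (fun x => f x - ∑ k ∈ s, a k * expI k x) < ε := by
  have hpi := Real.pi_pos
  have : Fact (0 < 2 * π) := ⟨by positivity⟩
  have hpp : -π + 2 * π = π := by ring
  have hm : MemLp (AddCircle.liftIoc (2 * π) (-π) f) 1 (AddCircle.haarAddCircle) := by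
    apply MemLp.haarAddCircle
    apply MemLp.memLp_liftIoc
    rw [memLp_one_iff_integrable, hpp]
    rwa [intervalIntegrable_iff_integrableOn_Ioc_of_le (by linarith)] at hf
  have hmem : hm.toLp ∈
      (Submodule.span ℂ (Set.range (@fourierLp (2 * π) _ 1 _))).topologicalClosure := by
    rw [span_fourierLp_closure_eq_top ENNReal.one_ne_top]; trivial
  -- Haar measure on the circle has mass one, hence the tolerance `ε / (2π)`.
  obtain ⟨g, hg, hdist⟩ := Metric.mem_closure_iff.1 hmem (ε / (2 * π)) (by positivity)
  obtain ⟨a, rfl⟩ := Finsupp.mem_span_range_iff_exists_finsupp.1 hg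
  refine ⟨a, a.support, ?_⟩
  rw [dist_eq_norm, L1.norm_eq_integral_norm] at hdist
  have hae : ∀ᵐ z ∂(AddCircle.haarAddCircle : Measure (AddCircle (2 * π))),
      ‖(hm.toLp - a.sum fun i c => c • fourierLp 1 i : Lp ℂ 1 AddCircle.haarAddCircle) z‖ =
      ‖AddCircle.liftIoc (2 * π) (-π) f z - ∑ k ∈ a.support, a k * fourier k z‖ := by
    have h1 : ∀ s : Finset ℤ, ∀ᵐ z ∂(AddCircle.haarAddCircle : Measure (AddCircle (2 * π))),
        (∑ k ∈ s, a k • fourierLp 1 k : Lp ℂ 1 AddCircle.haarAddCircle) z =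
          ∑ k ∈ s, a k * fourier k z := by
      intro s
      induction s using Finset.induction_on with
      | empty =>
        simp only [Finset.sum_empty]
        exact Lp.coeFn_zero _ _ _
      | insert k s hk ih =>
        simp only [Finset.sum_insert hk]
        filter_upwards [ih, Lp.coeFn_add (a k • fourierLp 1 k)
          (∑ k ∈ s, a k • fourierLp 1 k : Lp ℂ 1 AddCircle.haarAddCircle),
          Lp.coeFn_smul (a k) (fourierLp (T := 2 * π) 1 k), coeFn_fourierLp (T := 2 * π) 1 k]
          with z h1 h2 h3 h4
        rw [h2, Pi.add_apply, h1, h3, Pi.smul_apply, h4, smul_eq_mul]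
    filter_upwards [h1 a.support, Lp.coeFn_sub hm.toLp
      (a.sum fun i c => c • fourierLp 1 i : Lp ℂ 1 AddCircle.haarAddCircle), hm.coeFn_toLp]
      with z h1 h2 h3
    rw [h2, Pi.sub_apply, h3, Finsupp.sum, h1]
  rw [integral_congr_ae hae, AddCircle.integral_haarAddCircle,
    ← AddCircle.intervalIntegral_preimage _ (-π), hpp, smul_eq_mul, inv_mul_eq_div,
    div_lt_div_iff_of_pos_right (by positivity)] at hdist
  refine lt_of_eq_of_lt ?_ hdist
  unfold L1norm
  rw [intervalIntegral.integral_of_le (by linarith), intervalIntegral.integral_of_le (by linarith)]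
  refine setIntegral_congr_fun measurableSet_Ioc fun x hx => ?_
  simp only
  rw [AddCircle.liftIoc_coe_apply (by rwa [hpp])]
  simp only [fourier_coe_eq_expI rfl]

theorem fhat_sub {f g : ℝ → ℂ} (hf : IntervalIntegrable f volume (-π) π)
    (hg : IntervalIntegrable g volume (-π) π) (k : ℤ) :
    fhat (fun x => f x - g x) k = fhat f k - fhat g k := by
  simp only [fhat_eq_integral, mul_sub]
  rw [intervalIntegral.integral_sub (hf.continuousOn_mul (continuous_expI _).continuousOn)
    (hg.continuousOn_mul (continuous_expI _).continuousOn), mul_sub]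

theorem fhat_trigPoly (a : ℤ → ℂ) (s : Finset ℤ) (k : ℤ) :
    fhat (fun x => ∑ j ∈ s, a j * expI j x) k = if k ∈ s then a k else 0 := by
  have h : ∀ x, expI (-k) x * ∑ j ∈ s, a j * expI j x = ∑ j ∈ s, a j * expI (j - k) (x - 0) := by
    intro x
    rw [Finset.mul_sum]
    refine Finset.sum_congr rfl fun j _ => ?_
    rw [sub_zero, sub_eq_add_neg, expI_add]; ring
  rw [fhat_eq_integral]
  simp only [h]
  rw [intervalIntegral.integral_finsetSum]
  · simp only [intervalIntegral.integral_const_mul, integral_expI, sub_eq_zero]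
    have : (2 * π : ℂ) ≠ 0 := by exact_mod_cast (by positivity : (2 * π : ℝ) ≠ 0)
    simp only [mul_ite, mul_zero, Finset.sum_ite_eq']
    split_ifs
    · field_simp
    · rfl
  · intro j _
    simp only [sub_zero]
    exact (continuous_const.mul (continuous_expI _)).intervalIntegrable _ _

theorem exists_partialSum_trigPoly (a : ℤ → ℂ) (s : Finset ℤ) :
    ∃ N : ℕ, ∀ n, N ≤ n → ∀ x,
      partialSum (fun x => ∑ j ∈ s, a j * expI j x) n x = ∑ j ∈ s, a j * expI j x := by
  refine ⟨s.sup Int.natAbs, fun n hn x => ?_⟩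
  have hsub : s ⊆ Finset.Icc (-(n : ℤ)) n := fun k hk => by
    have := (Finset.le_sup (f := Int.natAbs) hk).trans hn
    rw [Finset.mem_Icc]; omega
  rw [partialSum_eq]
  simp only [fhat_trigPoly]
  rw [← Finset.sum_subset hsub]
  · exact Finset.sum_congr rfl fun k hk => by rw [if_pos hk]
  · intro k _ hk; rw [if_neg hk, zero_mul]

theorem partialSum_fun_sub {f g : ℝ → ℂ} (hf : IntervalIntegrable f volume (-π) π)
    (hg : IntervalIntegrable g volume (-π) π) (n : ℕ) (x : ℝ) :
    partialSum (fun x => f x - g x) n x = partialSum f n x - partialSum g n x := by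
  simp only [partialSum_eq, fhat_sub hf hg, sub_mul, Finset.sum_sub_distrib]

/-- The de la Vallée-Poussin estimate. -/
theorem exists_sub_mul_L1norm_sub_partialSum_le {f : ℝ → ℂ}
    (hf : IntervalIntegrable f volume (-π) π) {ε : ℝ} (hε : 0 < ε) :
    ∃ N : ℕ, ∀ n m : ℕ, N ≤ n → n ≤ m →
      ((m : ℝ) - n) * L1norm (fun x => f x - partialSum f n x) ≤ 2 * m * ε +
        ∑ j ∈ Finset.Ico n m, L1norm (fun x => partialSum f j x - partialSum f n x) := by
  obtain ⟨a, s, hs⟩ := exists_trigPoly_L1norm_sub_lt hf hε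
  obtain ⟨N, hN⟩ := exists_partialSum_trigPoly a s
  set P : ℝ → ℂ := fun x => ∑ k ∈ s, a k * expI k x with hP
  have hPi : IntervalIntegrable P volume (-π) π :=
    (continuous_finsetSum _ fun k _ =>
      continuous_const.mul (continuous_expI k)).intervalIntegrable _ _
  set h : ℝ → ℂ := fun x => f x - P x with hh
  have hhi : IntervalIntegrable h volume (-π) π := hf.sub hPi
  refine ⟨N, fun n m hn hnm => ?_⟩
  have hSi : ∀ (g : ℝ → ℂ) (j : ℕ), IntervalIntegrable (partialSum g j) volume (-π) π :=
    fun g j => (continuous_partialSum g j).intervalIntegrable _ _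
  have hsum : ∀ (g : ℝ → ℂ) (r : Finset ℕ),
      IntervalIntegrable (fun x => ∑ j ∈ r, partialSum g j x) volume (-π) π := fun g r =>
    (continuous_finsetSum _ fun j _ => continuous_partialSum g j).intervalIntegrable _ _
  have hdi : IntervalIntegrable (fun x => ∑ j ∈ Finset.Ico n m,
      (partialSum f j x - partialSum f n x)) volume (-π) π :=
    (continuous_finsetSum _ fun j _ =>
      (continuous_partialSum f j).sub (continuous_partialSum f n)).intervalIntegrable _ _
  -- For `j ≥ n ≥ N` the partial sum of `P` is `P` itself, so `P` cancels from the average over `[n,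
  -- m)`. What remains of `h` costs at most `((m - n) + m + n) ε = 2mε`.
  have hid : ∀ x, (((m : ℝ) - n : ℝ) : ℂ) * (f x - partialSum f n x) =
      ((((m : ℝ) - n : ℝ) : ℂ) * h x - (∑ j ∈ Finset.range m, partialSum h j x -
        ∑ j ∈ Finset.range n, partialSum h j x)) +
      ∑ j ∈ Finset.Ico n m, (partialSum f j x - partialSum f n x) := by
    intro x
    rw [← Finset.sum_Ico_eq_sub _ hnm]
    have h1 : ∀ j ∈ Finset.Ico n m, partialSum h j x = partialSum f j x - P x := fun j hj => by
      rw [hh, partialSum_fun_sub hf hPi, hN j (hn.trans (Finset.mem_Ico.1 hj).1)]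
    rw [Finset.sum_congr rfl h1, Finset.sum_sub_distrib, Finset.sum_sub_distrib]
    simp only [Finset.sum_const, Nat.card_Ico, nsmul_eq_mul, hh]
    push_cast [Nat.cast_sub hnm]
    ring
  have hmn : (0 : ℝ) ≤ (m : ℝ) - n := by
    rw [sub_nonneg]; exact_mod_cast hnm
  have e1 : ((m : ℝ) - n) * L1norm (fun x => f x - partialSum f n x) =
      L1norm (fun x => (((m : ℝ) - n : ℝ) : ℂ) * (f x - partialSum f n x)) := by
    rw [L1norm_const_mul, Complex.norm_real, Real.norm_of_nonneg hmn]
  have e2 : L1norm (fun x => (((m : ℝ) - n : ℝ) : ℂ) * h x) = ((m : ℝ) - n) * L1norm h := by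
    rw [L1norm_const_mul, Complex.norm_real, Real.norm_of_nonneg hmn]
  rw [e1]
  simp only [hid]
  have i1 := L1norm_add_le ((hhi.const_mul (((m : ℝ) - n : ℝ) : ℂ)).sub
    ((hsum h (Finset.range m)).sub (hsum h (Finset.range n)))) hdi
  have i2 := L1norm_sub_le (hhi.const_mul (((m : ℝ) - n : ℝ) : ℂ))
    ((hsum h (Finset.range m)).sub (hsum h (Finset.range n)))
  have i3 := L1norm_sub_le (hsum h (Finset.range m)) (hsum h (Finset.range n))
  have i4 := L1norm_sum_partialSum_le hhi m
  have i5 := L1norm_sum_partialSum_le hhi n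
  have i6 := L1norm_sum_le (Finset.Ico n m)
    (g := fun j x => partialSum f j x - partialSum f n x) fun j _ => (hSi f j).sub (hSi f n)
  have i7 : (m : ℝ) * L1norm h ≤ m * ε := mul_le_mul_of_nonneg_left hs.le (Nat.cast_nonneg m)
  refine i1.trans (add_le_add (i2.trans ?_) i6)
  rw [e2]
  linarith

/-! ### Consequences of the L¹ Cauchy condition. -/

/-- The symmetric trigonometric block `∑_{n<k≤m} (c_k e^{ikx} + d_k e^{-ikx})`. -/
noncomputable def block (c d : ℕ → ℂ) (n m : ℕ) (x : ℝ) : ℂ :=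
  ∑ k ∈ Finset.Ioc n m, (c k * expI k x + d k * expI (-k) x)

/-- The partial sums of `∑ (c_k e^{ikx} + d_k e^{-ikx})` form a Cauchy sequence in `L¹`. -/
def CauchyL1 (c d : ℕ → ℂ) : Prop :=
  ∀ ε > 0, ∃ N : ℕ, ∀ n m, N ≤ n → n ≤ m → L1norm (block c d n m) ≤ ε

theorem L1norm_block_swap (c d : ℕ → ℂ) (n m : ℕ) :
    L1norm (block d c n m) = L1norm (block c d n m) :=
  L1norm_sum_swap _ _ _

theorem CauchyL1.swap {c d : ℕ → ℂ} (h : CauchyL1 c d) : CauchyL1 d c := fun ε hε => by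
  simpa only [L1norm_block_swap c d] using h ε hε

/-- This is the sawtooth inequality for a block with one frequency pair. As `1/3 < 1`, the bound and
its twin with `c` and `d` exchanged can be solved for both coefficients. -/
theorem norm_succ_le_L1norm_block (c d : ℕ → ℂ) {n : ℕ} (hn : 1 ≤ n) :
    ‖c (n + 1)‖ ≤ 1 / 2 * L1norm (block c d n (n + 1)) + 1 / 3 * ‖d (n + 1)‖ := by
  have h := norm_sum_div_le_L1norm c d n (n + 1)
  have hs : Finset.Ioc n (n + 1) = {n + 1} := by ext; simp
  rw [hs, Finset.sum_singleton, ← hs] at h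
  have h1 : (((n + 1 : ℕ) : ℂ) - n) = 1 := by push_cast; ring
  rw [h1, div_one] at h
  have h2 : ‖d (n + 1) / (((n + 1 : ℕ) : ℂ) + n)‖ ≤ 1 / 3 * ‖d (n + 1)‖ := by
    have h3 : ‖(((n + 1 : ℕ) : ℂ) + n)‖ = 2 * n + 1 := by
      have : (((n + 1 : ℕ) : ℂ) + n) = ((2 * n + 1 : ℕ) : ℂ) := by push_cast; ring
      rw [this, Complex.norm_natCast]; push_cast; ring
    have h4 : (1 : ℝ) ≤ n := by exact_mod_cast hn
    rw [norm_div, h3, div_le_iff₀ (by positivity)]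
    nlinarith [norm_nonneg (d (n + 1))]
  have h5 := norm_sub_norm_le (c (n + 1)) (d (n + 1) / (((n + 1 : ℕ) : ℂ) + n))
  have h6 : L1norm (fun x => ∑ k ∈ Finset.Ioc n (n + 1), (c k * expI k x + d k * expI (-k) x)) =
    L1norm (block c d n (n + 1)) := rfl
  linarith

theorem CauchyL1.eventually_norm_le {c d : ℕ → ℂ} (h : CauchyL1 c d) {ε : ℝ} (hε : 0 < ε) :
    ∃ N : ℕ, ∀ k, N ≤ k → ‖d k‖ ≤ ε := by
  obtain ⟨N₁, h₁⟩ := h (ε / 2) (by positivity)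
  obtain ⟨N₂, h₂⟩ := h.swap (ε / 2) (by positivity)
  refine ⟨N₁ + N₂ + 2, fun k hk => ?_⟩
  obtain ⟨n, rfl⟩ : ∃ n, k = n + 1 := ⟨k - 1, by omega⟩
  have a1 := h₁ n (n + 1) (by omega) (by omega)
  have a2 := h₂ n (n + 1) (by omega) (by omega)
  have a3 := norm_succ_le_L1norm_block c d (n := n) (by omega)
  have a4 := norm_succ_le_L1norm_block d c (n := n) (by omega)
  linarith [norm_nonneg (c (n + 1))]

theorem CauchyL1.eventually_norm_sum_div_le {c d : ℕ → ℂ} (h : CauchyL1 c d) {ε : ℝ}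
    (hε : 0 < ε) :
    ∃ N : ℕ, ∀ n m, N ≤ n → n ≤ m → m ≤ 2 * n →
      ‖∑ k ∈ Finset.Ioc n m, c k / ((k : ℂ) - n)‖ ≤ ε := by
  obtain ⟨N₁, h₁⟩ := h ε hε
  obtain ⟨N₂, h₂⟩ := h.eventually_norm_le (half_pos hε)
  refine ⟨N₁ + N₂ + 1, fun n m hn hnm hm => ?_⟩
  have a1 := h₁ n m (by omega) hnm
  have a2 := norm_sum_div_le_L1norm c d n m
  have hn0 : (0 : ℝ) < n := by exact_mod_cast (by omega : 0 < n)
  -- As `m ≤ 2n`, there are at most `n` terms, each at most `(ε/2) / n`.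
  have a3 : ‖∑ k ∈ Finset.Ioc n m, d k / ((k : ℂ) + n)‖ ≤ ε / 2 := by
    have hterm : ∀ k ∈ Finset.Ioc n m, ‖d k / ((k : ℂ) + n)‖ ≤ ε / 2 / n := fun k hk => by
      rw [Finset.mem_Ioc] at hk
      have : ((k : ℂ) + n) = ((k + n : ℕ) : ℂ) := by push_cast; ring
      rw [norm_div, this, Complex.norm_natCast]
      refine div_le_div₀ (by positivity) (h₂ k (by omega)) hn0 ?_
      exact_mod_cast (by omega : n ≤ k + n)
    refine (norm_sum_le_of_le _ hterm).trans ?_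
    rw [Finset.sum_const, Nat.card_Ioc, nsmul_eq_mul]
    have : ((m - n : ℕ) : ℝ) ≤ n := by exact_mod_cast (by omega : m - n ≤ n)
    calc ((m - n : ℕ) : ℝ) * (ε / 2 / n) ≤ n * (ε / 2 / n) :=
          mul_le_mul_of_nonneg_right this (by positivity)
      _ = ε / 2 := by field_simp
  rw [Finset.sum_sub_distrib] at a2
  have a4 := norm_sub_norm_le (∑ k ∈ Finset.Ioc n m, c k / ((k : ℂ) - n))
    (∑ k ∈ Finset.Ioc n m, d k / ((k : ℂ) + n))
  have a5 : L1norm (fun x => ∑ k ∈ Finset.Ioc n m, (c k * expI k x + d k * expI (-k) x)) =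
    L1norm (block c d n m) := rfl
  linarith

/-! ### Decay of the coefficients of nonnegative index. -/

/-- Real parts dominate norms in the sector, so sums with nonnegative weights cannot cancel. -/
theorem cos_mul_norm_le_re {θ : ℝ} (hθ : θ < π / 2) {z : ℂ} (hz : z ∈ sector θ) :
    Real.cos θ * ‖z‖ ≤ z.re := by
  rw [← Complex.norm_mul_cos_arg z, mul_comm]
  refine mul_le_mul_of_nonneg_left ?_ (norm_nonneg _)
  rw [← Real.cos_abs (Complex.arg z)]
  exact Real.cos_le_cos_of_nonneg_of_le_pi (abs_nonneg _) (by linarith [Real.pi_pos]) hz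

theorem norm_sub_le_sum_delta (c : ℕ → ℂ) {n m : ℕ} (h : n ≤ m) :
    ‖c m - c n‖ ≤ ∑ k ∈ Finset.Ico n m, ‖delta c k‖ := by
  have h1 : c m - c n = -∑ k ∈ Finset.Ico n m, delta c k := by
    rw [← Finset.sum_Ico_sub c h, ← Finset.sum_neg_distrib]
    exact Finset.sum_congr rfl fun k _ => by rw [delta]; ring
  rw [h1, norm_neg]
  exact norm_sum_le _ _

theorem log_le_sum_inv (J : ℕ) :
    Real.log ((J + 1 : ℕ) : ℝ) ≤ ∑ j ∈ Finset.range J, ((j : ℝ) + 1)⁻¹ := by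
  have := log_add_one_le_harmonic J
  simpa [harmonic] using this

/-- In a sequence of class GBV each term is controlled by any preceding window of fixed length
within a factor `2`. -/
theorem GBV.exists_norm_le_sum {c : ℕ → ℂ} (hc : GBV c) :
    ∃ (N₀ : ℕ) (B : ℝ), 0 < N₀ ∧ 0 < B ∧ ∀ k p : ℕ, 1 ≤ k → k ≤ p → p ≤ 2 * k →
      ‖c p‖ ≤ B * ∑ i ∈ Finset.range N₀, ‖c (k + i)‖ := by
  obtain ⟨-, N₀, hN, M, hM, h⟩ := hc
  refine ⟨N₀, M + 1, hN, by linarith, fun k p hk hkp hp => ?_⟩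
  have hw : ∀ n ∈ Finset.Ico k (k + N₀), ‖c n‖ ≤ ∑ i ∈ Finset.range N₀, ‖c (k + i)‖ := by
    intro n hn
    rw [Finset.mem_Ico] at hn
    -- The maximum over the window is relaxed to a sum, which can later be interchanged with the
    -- harmonic sum.
    have := Finset.single_le_sum (f := fun i => ‖c (k + i)‖) (fun i _ => norm_nonneg _)
      (Finset.mem_range.2 (by omega : n - k < N₀))
    simpa [Nat.add_sub_cancel' hn.1] using this
  have h1 := norm_sub_le_sum_delta c hkp
  have h2 : ∑ n ∈ Finset.Ico k p, ‖delta c n‖ ≤ ∑ n ∈ Finset.Icc k (2 * k), ‖delta c n‖ := by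
    refine Finset.sum_le_sum_of_subset_of_nonneg ?_ fun _ _ _ => norm_nonneg _
    intro n; simp only [Finset.mem_Ico, Finset.mem_Icc]; omega
  have h3 := h k hk
  have h4 : (Finset.Ico k (k + N₀)).sup'
      (Finset.nonempty_Ico.2 (Nat.lt_add_of_pos_right hN)) (fun n => ‖c n‖) ≤
      ∑ i ∈ Finset.range N₀, ‖c (k + i)‖ := Finset.sup'_le _ _ hw
  have h5 := hw k (Finset.mem_Ico.2 ⟨le_rfl, by omega⟩)
  have h6 : ‖c p‖ ≤ ‖c k‖ + ‖c p - c k‖ := by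
    have := norm_add_le (c k) (c p - c k)
    rwa [add_sub_cancel] at this
  have h7 := mul_le_mul_of_nonneg_left h4 hM.le
  linarith

/-- Shifting by `i < N₀` costs only the factor `N₀` in the weight, because `j + 1 + i ≤ N₀ (j + 1)`;
the room `J + N₀ ≤ n` keeps the shifted indices in `(n, 2n]`. -/
theorem sum_window_div_le {c : ℕ → ℂ} {N₀ J n i : ℕ} (hi : i < N₀) (hJ : J + N₀ ≤ n) :
    ∑ j ∈ Finset.range J, ‖c (n + (j + 1) + i)‖ * ((j : ℝ) + 1)⁻¹ ≤
      N₀ * ∑ k ∈ Finset.Ioc n (2 * n), ‖c k‖ * ((k : ℝ) - n)⁻¹ := by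
  have hnonneg : ∀ k ∈ Finset.Ioc n (2 * n), 0 ≤ ‖c k‖ * ((k : ℝ) - n)⁻¹ := fun k hk => by
    have : (n : ℝ) ≤ k := by exact_mod_cast (Finset.mem_Ioc.1 hk).1.le
    exact mul_nonneg (norm_nonneg _) (inv_nonneg.2 (by linarith))
  have hinj : Set.InjOn (fun j : ℕ => n + (j + 1) + i) (Finset.range J) := fun a _ b _ h => by
    simpa using h
  have h1 : ∑ j ∈ Finset.range J,
      ‖c (n + (j + 1) + i)‖ * (((n + (j + 1) + i : ℕ) : ℝ) - n)⁻¹ ≤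
      ∑ k ∈ Finset.Ioc n (2 * n), ‖c k‖ * ((k : ℝ) - n)⁻¹ := by
    rw [← Finset.sum_image (f := fun k : ℕ => ‖c k‖ * ((k : ℝ) - n)⁻¹) hinj]
    refine Finset.sum_le_sum_of_subset_of_nonneg ?_ fun k hk _ => hnonneg k hk
    intro k hk
    simp only [Finset.mem_image, Finset.mem_range] at hk
    obtain ⟨j, hj, rfl⟩ := hk
    rw [Finset.mem_Ioc]; omega
  refine le_trans ?_ (mul_le_mul_of_nonneg_left h1 (Nat.cast_nonneg N₀))
  rw [Finset.mul_sum]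
  refine Finset.sum_le_sum fun j _ => ?_
  rw [mul_left_comm]
  refine mul_le_mul_of_nonneg_left ?_ (norm_nonneg _)
  have e1 : ((n + (j + 1) + i : ℕ) : ℝ) - n = (j : ℝ) + 1 + i := by push_cast; ring
  have hi' : (i : ℝ) + 1 ≤ N₀ := by exact_mod_cast hi
  have hj : (0 : ℝ) ≤ j := Nat.cast_nonneg j
  have hi0 : (0 : ℝ) ≤ i := Nat.cast_nonneg i
  rw [e1, ← div_eq_mul_inv, inv_eq_one_div, div_le_div_iff₀ (by positivity) (by positivity)]
  nlinarith [mul_nonneg hj hi0, mul_le_mul_of_nonneg_right hi' (by positivity : 0 ≤ (j : ℝ) + 1)]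

theorem GBV.eventually_norm_mul_log_le {c d : ℕ → ℂ} (hc : GBV c) (h : CauchyL1 c d) {ε : ℝ}
    (hε : 0 < ε) : ∃ N : ℕ, ∀ p, N ≤ p → ‖c p‖ * Real.log p ≤ ε := by
  obtain ⟨N₀, B, hN₀, hB, hw⟩ := hc.exists_norm_le_sum
  obtain ⟨⟨θ, hθ0, hθ, hsec⟩, -⟩ := hc
  have hcos : 0 < Real.cos θ := Real.cos_pos_of_mem_Ioo ⟨by linarith [Real.pi_pos], hθ⟩
  have hN₀' : (0 : ℝ) < N₀ := by exact_mod_cast hN₀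
  obtain ⟨η, hη, hηε⟩ : ∃ η > 0, 2 * (B * (N₀ * (N₀ * (η / Real.cos θ)))) = ε :=
    ⟨ε * Real.cos θ / (2 * B * N₀ * N₀), by positivity, by field_simp⟩
  obtain ⟨N, hN⟩ := h.eventually_norm_sum_div_le hη
  refine ⟨2 * (N + 2 * N₀ + 5), fun p hp => ?_⟩
  -- With `n = p / 2` and `J = n - N₀`, each `k = n + j + 1` with `j < J` satisfies `k ≤ p ≤ 2k`, so
  -- its window controls `c p`.
  obtain ⟨n, hn⟩ : ∃ n, n = p / 2 := ⟨_, rfl⟩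
  obtain ⟨J, hJ⟩ : ∃ J, J = n - N₀ := ⟨_, rfl⟩
  have hW : ∑ k ∈ Finset.Ioc n (2 * n), ‖c k‖ * ((k : ℝ) - n)⁻¹ ≤ η / Real.cos θ := by
    rw [le_div_iff₀ hcos, mul_comm, Finset.mul_sum]
    have h1 := hN n (2 * n) (by omega) (by omega) le_rfl
    refine le_trans ?_ ((Complex.re_le_norm _).trans h1)
    rw [Complex.re_sum]
    refine Finset.sum_le_sum fun k hk => ?_
    rw [Finset.mem_Ioc] at hk
    have hkn : (n : ℝ) ≤ k := by exact_mod_cast hk.1.le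
    have e1 : c k / ((k : ℂ) - n) = c k * (((k : ℝ) - n)⁻¹ : ℝ) := by
      push_cast; rw [div_eq_mul_inv]
    rw [e1, Complex.re_mul_ofReal, ← mul_assoc]
    exact mul_le_mul_of_nonneg_right (cos_mul_norm_le_re hθ (hsec k (by omega)))
      (inv_nonneg.2 (by linarith))
  have h1 : ‖c p‖ * ∑ j ∈ Finset.range J, ((j : ℝ) + 1)⁻¹ ≤
      B * (N₀ * (N₀ * (η / Real.cos θ))) := by
    calc ‖c p‖ * ∑ j ∈ Finset.range J, ((j : ℝ) + 1)⁻¹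
        = ∑ j ∈ Finset.range J, ‖c p‖ * ((j : ℝ) + 1)⁻¹ := Finset.mul_sum _ _ _
      _ ≤ ∑ j ∈ Finset.range J,
          (B * ∑ i ∈ Finset.range N₀, ‖c (n + (j + 1) + i)‖) * ((j : ℝ) + 1)⁻¹ := by
          refine Finset.sum_le_sum fun j hj => ?_
          rw [Finset.mem_range] at hj
          exact mul_le_mul_of_nonneg_right (hw _ _ (by omega) (by omega) (by omega))
            (by positivity)
      _ = B * ∑ i ∈ Finset.range N₀, ∑ j ∈ Finset.range J,
          ‖c (n + (j + 1) + i)‖ * ((j : ℝ) + 1)⁻¹ := by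
          rw [Finset.sum_comm, Finset.mul_sum]
          refine Finset.sum_congr rfl fun j _ => ?_
          rw [mul_assoc, Finset.sum_mul]
      _ ≤ B * ∑ i ∈ Finset.range N₀, (N₀ * (η / Real.cos θ)) := by
          refine mul_le_mul_of_nonneg_left (Finset.sum_le_sum fun i hi => ?_) hB.le
          refine (sum_window_div_le (N₀ := N₀) (Finset.mem_range.1 hi) (by omega)).trans ?_
          exact mul_le_mul_of_nonneg_left hW hN₀'.le
      _ = B * (N₀ * (N₀ * (η / Real.cos θ))) := by simp
  -- For large `p`, `p ≤ 4J + 1 ≤ (J + 1) ^ 2`; hence the factor `2`.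
  have h2 : Real.log p ≤ 2 * ∑ j ∈ Finset.range J, ((j : ℝ) + 1)⁻¹ := by
    have h3 := log_le_sum_inv J
    have h4 : Real.log p ≤ Real.log (((J + 1 : ℕ) : ℝ) ^ 2) := by
      apply Real.log_le_log
      · exact_mod_cast (by omega : 0 < p)
      · have h5 : p ≤ 4 * J + 1 := by omega
        have h6 : 4 ≤ J := by omega
        exact_mod_cast (by nlinarith : p ≤ (J + 1) ^ 2)
    rw [Real.log_pow] at h4
    push_cast at h4 h3 ⊢
    linarith
  have h3 := mul_le_mul_of_nonneg_left h2 (norm_nonneg (c p))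
  linarith

/-! ### Decay of the difference between coefficients at opposite indices. -/

theorem sum_Ioc_inv (n m : ℕ) (h : n ≤ m) :
    ∑ k ∈ Finset.Ioc n m, ((k : ℝ) - n)⁻¹ = ∑ j ∈ Finset.range (m - n), ((j : ℝ) + 1)⁻¹ := by
  induction m, h using Nat.le_induction with
  | base => simp
  | succ m hm ih =>
    rw [Finset.sum_Ioc_succ_top (by omega), ih, Nat.succ_sub hm, Finset.sum_range_succ]
    congr 2
    push_cast [Nat.cast_sub hm]; ring

theorem CauchyL1.eventually_norm_sub_mul_log_le {c d : ℕ → ℂ} (h : CauchyL1 c d) {lam ε : ℝ}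
    (hlam : 1 < lam) (hlam' : lam < 2) (hε : 0 < ε)
    (hbal : ∀ᶠ n : ℕ in atTop,
      ∑ k ∈ Finset.Icc n ⌊lam * n⌋₊, ‖delta c k - delta d k‖ * Real.log k ≤ ε) :
    ∃ N : ℕ, ∀ n, N ≤ n → ‖c n - d n‖ * Real.log n ≤ 5 * ε := by
  obtain ⟨N₁, h₁⟩ := h.eventually_norm_sum_div_le hε
  obtain ⟨N₂, h₂⟩ := h.swap.eventually_norm_sum_div_le hε
  obtain ⟨N₃, h₃⟩ := eventually_atTop.1 hbal
  -- This makes `(λ - 1)² n ≥ 1`, whence `(m - n + 1)² ≥ n` and `log n ≤ 2H`.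
  obtain ⟨N₄, h₄⟩ := exists_nat_ge (1 / (lam - 1) ^ 2)
  refine ⟨N₁ + N₂ + N₃ + N₄ + 2, fun n hn => ?_⟩
  obtain ⟨m, hm⟩ : ∃ m, m = ⌊lam * n⌋₊ := ⟨_, rfl⟩
  have hn0 : (0 : ℝ) < n := by exact_mod_cast (by omega : 0 < n)
  have hnm : n ≤ m := by
    rw [hm]; apply Nat.le_floor; nlinarith
  have hm2 : m ≤ 2 * n := by
    rw [hm]; apply Nat.floor_le_of_le; push_cast; nlinarith
  have hlogn : 0 < Real.log n := Real.log_pos (by exact_mod_cast (by omega : 1 < n))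
  set g : ℕ → ℂ := fun k => c k - d k with hg
  set H : ℝ := ∑ k ∈ Finset.Ioc n m, ((k : ℝ) - n)⁻¹ with hH
  have hkn : ∀ k ∈ Finset.Ioc n m, (0 : ℝ) < (k : ℝ) - n := fun k hk => by
    rw [sub_pos]; exact_mod_cast (Finset.mem_Ioc.1 hk).1
  have hlogH : Real.log n ≤ 2 * H := by
    have a1 := log_le_sum_inv (m - n)
    rw [← sum_Ioc_inv n m hnm] at a1
    have a2 : Real.log n ≤ Real.log (((m - n + 1 : ℕ) : ℝ) ^ 2) := by
      apply Real.log_le_log hn0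
      have a3 : (lam - 1) * n ≤ ((m - n + 1 : ℕ) : ℝ) := by
        push_cast [Nat.cast_sub hnm]
        have := Nat.lt_floor_add_one (lam * n)
        rw [← hm] at this
        linarith
      have a4 : (1 : ℝ) ≤ (lam - 1) ^ 2 * n := by
        have : (N₄ : ℝ) ≤ n := by exact_mod_cast (by omega : N₄ ≤ n)
        have a5 := h₄.trans this
        rw [div_le_iff₀ (by nlinarith)] at a5
        linarith
      have a6 := pow_le_pow_left₀ (by nlinarith : 0 ≤ (lam - 1) * n) a3 2
      nlinarith
    rw [Real.log_pow] at a2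
    push_cast at a2 a1 ⊢
    linarith
  have hdiff : ∀ k ∈ Finset.Ioc n m, ‖g k - g n‖ * Real.log n ≤ ε := fun k hk => by
    rw [Finset.mem_Ioc] at hk
    have a1 := norm_sub_le_sum_delta g hk.1.le
    have a2 := h₃ n (by omega)
    rw [← hm] at a2
    refine le_trans ?_ a2
    refine (mul_le_mul_of_nonneg_right a1 hlogn.le).trans ?_
    rw [Finset.sum_mul]
    have hsub : Finset.Ico n k ⊆ Finset.Icc n m := fun j => by
      simp only [Finset.mem_Ico, Finset.mem_Icc]; omega
    calc ∑ j ∈ Finset.Ico n k, ‖delta g j‖ * Real.log n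
        ≤ ∑ j ∈ Finset.Ico n k, ‖delta c j - delta d j‖ * Real.log j := by
          refine Finset.sum_le_sum fun j hj => ?_
          rw [Finset.mem_Ico] at hj
          have e1 : delta g j = delta c j - delta d j := by simp only [hg, delta]; ring
          rw [e1]
          exact mul_le_mul_of_nonneg_left
            (Real.log_le_log hn0 (by exact_mod_cast hj.1)) (norm_nonneg _)
      _ ≤ _ := Finset.sum_le_sum_of_subset_of_nonneg hsub fun j _ _ =>
          mul_nonneg (norm_nonneg _) (Real.log_natCast_nonneg j)
  have hsum : ‖∑ k ∈ Finset.Ioc n m, g k / ((k : ℂ) - n)‖ ≤ 2 * ε := by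
    have a1 := h₁ n m (by omega) hnm hm2
    have a2 := h₂ n m (by omega) hnm hm2
    simp only [hg, sub_div, Finset.sum_sub_distrib]
    refine (norm_sub_le _ _).trans ?_
    linarith
  -- Write `g n` times `H` as the weighted sum of `g k` minus that of `g k - g n`: the sawtooth
  -- bounds the first, balance the second. Inserting `log n ≤ 2H` afterwards gives `4ε + ε = 5ε`.
  have hmain : ‖g n‖ * H * Real.log n ≤ 2 * ε * Real.log n + ε * H := by
    have e1 : g n * (H : ℂ) = ∑ k ∈ Finset.Ioc n m, g k / ((k : ℂ) - n) -
        ∑ k ∈ Finset.Ioc n m, (g k - g n) / ((k : ℂ) - n) := by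
      rw [← Finset.sum_sub_distrib, hH]
      push_cast
      rw [Finset.mul_sum]
      exact Finset.sum_congr rfl fun k _ => by rw [div_eq_mul_inv, div_eq_mul_inv]; ring
    have hH0 : 0 ≤ H := Finset.sum_nonneg fun k hk => (inv_pos.2 (hkn k hk)).le
    have e2 : ‖g n‖ * H = ‖g n * (H : ℂ)‖ := by
      rw [norm_mul, Complex.norm_real, Real.norm_of_nonneg hH0]
    have e3 : ‖∑ k ∈ Finset.Ioc n m, (g k - g n) / ((k : ℂ) - n)‖ * Real.log n ≤ ε * H := by
      refine (mul_le_mul_of_nonneg_right (norm_sum_le _ _) hlogn.le).trans ?_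
      rw [Finset.sum_mul, hH, Finset.mul_sum]
      refine Finset.sum_le_sum fun k hk => ?_
      have e4 : ‖((k : ℂ) - n)‖ = (k : ℝ) - n := by
        have : ((k : ℂ) - n) = (((k : ℝ) - n : ℝ) : ℂ) := by push_cast; ring
        rw [this, Complex.norm_real, Real.norm_of_nonneg (hkn k hk).le]
      rw [norm_div, e4, div_eq_mul_inv, mul_right_comm]
      exact mul_le_mul_of_nonneg_right (hdiff k hk) (inv_pos.2 (hkn k hk)).le
    rw [e2, e1]
    refine (mul_le_mul_of_nonneg_right (norm_sub_le _ _) hlogn.le).trans ?_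
    rw [add_mul]
    exact add_le_add (mul_le_mul_of_nonneg_right hsum hlogn.le) e3
  have hHpos : 0 < H := by linarith
  have h5 : (‖g n‖ * Real.log n) * H ≤ (5 * ε) * H := by
    have := mul_le_mul_of_nonneg_left hlogH (by positivity : 0 ≤ 2 * ε)
    linarith
  exact le_of_mul_le_mul_right h5 hHpos

/-! ### Smallness of blocks from logarithmic decay. -/

theorem L1norm_block_le (c d : ℕ → ℂ) (n m : ℕ) :
    L1norm (block c d n m) ≤ L1norm (fun x => ∑ k ∈ Finset.Ioc n m, c k * expI k x) +
      L1norm (fun x => ∑ k ∈ Finset.Ioc n m, d k * expI k x) := by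
  have hi : ∀ (a : ℕ → ℂ) (σ : ℕ → ℤ),
      IntervalIntegrable (fun x => ∑ k ∈ Finset.Ioc n m, a k * expI (σ k) x) volume (-π) π :=
    fun a σ => (continuous_finsetSum _ fun k _ =>
      continuous_const.mul (continuous_expI (σ k))).intervalIntegrable _ _
  have h := L1norm_add_le (hi c fun k => k) (hi d fun k => -k)
  rw [← L1norm_comp_neg (fun x => ∑ k ∈ Finset.Ioc n m, d k * expI k x)]
  simp only [expI_neg_right]
  simp only [← Finset.sum_add_distrib] at h
  exact h

/-- The GBV maximum is attained at some `j ≥ n`, where the decay hypothesis applies; `log k ≤ 2 log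
n` on `[n, 2n]` accounts for the factor `2`. -/
theorem GBV.exists_sum_delta_mul_log_le {c : ℕ → ℂ} (hc : GBV c) :
    ∃ M : ℝ, 0 < M ∧ ∀ (N : ℕ) (ε : ℝ), (∀ n, N ≤ n → ‖c n‖ * Real.log n ≤ ε) →
      ∀ n, N ≤ n → 2 ≤ n → ∑ k ∈ Finset.Icc n (2 * n), ‖delta c k‖ * Real.log k ≤ M * ε := by
  obtain ⟨-, N₀, hN, M, hM, h⟩ := hc
  refine ⟨2 * M, by linarith, fun N ε hε n hn hn2 => ?_⟩
  have hn0 : (2 : ℝ) ≤ n := by exact_mod_cast hn2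
  have hlog : ∀ k ∈ Finset.Icc n (2 * n), Real.log k ≤ 2 * Real.log n := fun k hk => by
    rw [Finset.mem_Icc] at hk
    have h1 : Real.log k ≤ Real.log ((n : ℝ) ^ 2) := by
      apply Real.log_le_log (by exact_mod_cast (by omega : 0 < k))
      exact_mod_cast (by nlinarith : k ≤ n ^ 2)
    rw [Real.log_pow] at h1
    exact_mod_cast h1
  have hlogn : 0 ≤ Real.log n := Real.log_natCast_nonneg n
  obtain ⟨j, hj, hsup⟩ := Finset.exists_mem_eq_sup'
    (Finset.nonempty_Ico.2 (Nat.lt_add_of_pos_right hN : n < n + N₀)) (fun n => ‖c n‖)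
  have h1 := h n (by omega)
  rw [hsup] at h1
  rw [Finset.mem_Ico] at hj
  have h2 : ‖c j‖ * Real.log n ≤ ε := by
    refine le_trans ?_ (hε j (by omega))
    exact mul_le_mul_of_nonneg_left
      (Real.log_le_log (by linarith) (by exact_mod_cast hj.1)) (norm_nonneg _)
  calc ∑ k ∈ Finset.Icc n (2 * n), ‖delta c k‖ * Real.log k
      ≤ ∑ k ∈ Finset.Icc n (2 * n), ‖delta c k‖ * (2 * Real.log n) :=
        Finset.sum_le_sum fun k hk => mul_le_mul_of_nonneg_left (hlog k hk) (norm_nonneg _)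
    _ = (∑ k ∈ Finset.Icc n (2 * n), ‖delta c k‖) * (2 * Real.log n) := by
        rw [Finset.sum_mul]
    _ ≤ (M * ‖c j‖) * (2 * Real.log n) := mul_le_mul_of_nonneg_right h1 (by linarith)
    _ = 2 * M * (‖c j‖ * Real.log n) := by ring
    _ ≤ 2 * M * ε := mul_le_mul_of_nonneg_left h2 (by linarith)

theorem GBV.exists_L1norm_block_le {c : ℕ → ℂ} (hc : GBV c) :
    ∃ K : ℝ, 0 < K ∧ ∀ (d : ℕ → ℂ) (N : ℕ) (ε : ℝ),
      (∀ n, N ≤ n → ‖c n‖ * Real.log n ≤ ε) → (∀ n, N ≤ n → ‖d n‖ * Real.log n ≤ ε) →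
      ∀ n m j, N ≤ n → 2 ≤ n → n ≤ j → j ≤ m → m ≤ 2 * n →
      ∑ k ∈ Finset.Icc n m, ‖delta c k - delta d k‖ * Real.log k ≤ ε →
      L1norm (block c d n j) ≤ K * ε := by
  obtain ⟨C, hC, hblock⟩ := exists_L1norm_sum_Ioc_le
  obtain ⟨M, hM, hdelta⟩ := hc.exists_sum_delta_mul_log_le
  -- Four boundary terms give `4ε`, the differences of `c` give `Mε`, and those of `d` give `Mε +
  -- ε`.
  refine ⟨C * (5 + 2 * M), by positivity, fun d N ε h1 h2 n m j hn hn2 hnj hjm hm hbal => ?_⟩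
  have hnn : ∀ (z : ℂ) (k : ℕ), 0 ≤ ‖z‖ * Real.log k := fun z k =>
    mul_nonneg (norm_nonneg _) (Real.log_natCast_nonneg k)
  have a1 : ∑ k ∈ Finset.Ico n j, ‖delta c k‖ * Real.log k ≤ M * ε := by
    refine le_trans ?_ (hdelta N ε h1 n hn hn2)
    refine Finset.sum_le_sum_of_subset_of_nonneg ?_ fun k _ _ => hnn _ _
    intro k; simp only [Finset.mem_Ico, Finset.mem_Icc]; omega
  have a2 : ∑ k ∈ Finset.Ico n j, ‖delta c k - delta d k‖ * Real.log k ≤ ε := by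
    refine le_trans ?_ hbal
    refine Finset.sum_le_sum_of_subset_of_nonneg ?_ fun k _ _ => hnn _ _
    intro k; simp only [Finset.mem_Ico, Finset.mem_Icc]; omega
  have a3 : ∑ k ∈ Finset.Ico n j, ‖delta d k‖ * Real.log k ≤ M * ε + ε := by
    refine le_trans ?_ (add_le_add a1 a2)
    rw [← Finset.sum_add_distrib]
    refine Finset.sum_le_sum fun k _ => ?_
    rw [← add_mul]
    refine mul_le_mul_of_nonneg_right ?_ (Real.log_natCast_nonneg k)
    have := norm_sub_le (delta c k) (delta c k - delta d k)
    rwa [sub_sub_cancel] at this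
  have b1 := hblock c n j hn2 hnj
  have b2 := hblock d n j hn2 hnj
  have b3 := L1norm_block_le c d n j
  have c1 := h1 n hn
  have c2 := h1 j (by omega)
  have c3 := h2 n hn
  have c4 := h2 j (by omega)
  have b4 := mul_le_mul_of_nonneg_left (add_le_add (add_le_add c2 c1) a1) hC.le
  have b5 := mul_le_mul_of_nonneg_left (add_le_add (add_le_add c4 c3) a3) hC.le
  linarith

/-! ### The two implications. -/

theorem L1norm_partialSum_sub (f : ℝ → ℂ) {n m : ℕ} (h : n ≤ m) :
    L1norm (fun x => partialSum f m x - partialSum f n x) =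
      L1norm (block (fun j => fhat f j) (fun j => fhat f (-j)) n m) := by
  simp only [partialSum_sub f h]
  rfl

theorem exists_eventually_balanceSum_le {f : ℝ → ℂ}
    (hbal : Tendsto
      (fun lam : ℝ => limsup (fun n : ℕ => ((balanceSum f lam n : ℝ) : EReal)) atTop)
      (𝓝[>] (1 : ℝ)) (𝓝 (0 : EReal))) {ε : ℝ} (hε : 0 < ε) :
    ∃ lam : ℝ, 1 < lam ∧ lam < 2 ∧ ∀ᶠ n : ℕ in atTop, balanceSum f lam n ≤ ε := by
  have h1 : ∀ᶠ lam : ℝ in 𝓝[>] 1,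
      limsup (fun n : ℕ => ((balanceSum f lam n : ℝ) : EReal)) atTop < (ε : EReal) :=
    hbal.eventually (gt_mem_nhds (by exact_mod_cast hε))
  have h2 : ∀ᶠ lam : ℝ in 𝓝[>] 1, lam ∈ Set.Ioo (1 : ℝ) 2 :=
    Ioo_mem_nhdsGT one_lt_two
  obtain ⟨lam, hl, h3⟩ := (h1.and h2).exists
  refine ⟨lam, h3.1, h3.2, ?_⟩
  filter_upwards [eventually_lt_of_limsup_lt hl] with n hn
  exact (by exact_mod_cast hn : balanceSum f lam n < ε).le

theorem tendsto_fhat_mul_log_iff (f : ℝ → ℂ) :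
    Tendsto (fun n : ℤ => fhat f n * ((Real.log |(n : ℝ)| : ℝ) : ℂ)) cofinite (𝓝 0) ↔
      ∀ ε > 0, ∃ N : ℕ, ∀ n : ℕ, N ≤ n →
        ‖fhat f n‖ * Real.log n ≤ ε ∧ ‖fhat f (-n)‖ * Real.log n ≤ ε := by
  have hval : ∀ (k : ℤ) (n : ℕ), k.natAbs = n →
      ‖fhat f k * ((Real.log |(k : ℝ)| : ℝ) : ℂ)‖ = ‖fhat f k‖ * Real.log n := fun k n hk => by
    have : |(k : ℝ)| = n := by
      rw [← hk, Nat.cast_natAbs, Int.cast_abs]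
    rw [norm_mul, Complex.norm_real, this, Real.norm_of_nonneg (Real.log_natCast_nonneg n)]
  rw [Metric.tendsto_nhds]
  simp only [dist_zero_right]
  constructor
  · intro h ε hε
    have h1 := h ε hε
    rw [Int.cofinite_eq, eventually_sup, eventually_atBot, eventually_atTop] at h1
    obtain ⟨⟨a, ha⟩, ⟨b, hb⟩⟩ := h1
    refine ⟨a.natAbs + b.natAbs, fun n hn => ⟨?_, ?_⟩⟩
    · have := hb n (by omega)
      rw [hval n n (by simp)] at this
      exact this.le
    · have := ha (-n) (by omega)
      rw [hval (-n) n (by simp)] at this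
      exact this.le
  · intro h ε hε
    obtain ⟨N, hN⟩ := h (ε / 2) (half_pos hε)
    rw [Int.cofinite_eq, eventually_sup, eventually_atBot, eventually_atTop]
    refine ⟨⟨-N, fun k hk => ?_⟩, ⟨N, fun k hk => ?_⟩⟩
    · rw [hval k k.natAbs rfl]
      have h1 := (hN k.natAbs (by omega)).2
      rw [show -(k.natAbs : ℤ) = k by omega] at h1
      linarith
    · rw [hval k k.natAbs rfl]
      have h1 := (hN k.natAbs (by omega)).1
      rw [show (k.natAbs : ℤ) = k by omega] at h1
      linarith

theorem cauchyL1_of_tendsto {f : ℝ → ℂ} (hf : IntervalIntegrable f volume (-π) π)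
    (h : Tendsto (fun n : ℕ => L1norm (fun x => f x - partialSum f n x)) atTop (𝓝 0)) :
    CauchyL1 (fun j => fhat f j) (fun j => fhat f (-j)) := by
  intro ε hε
  obtain ⟨N, hN⟩ := eventually_atTop.1 (h.eventually (gt_mem_nhds (half_pos hε)))
  refine ⟨N, fun n m hn hnm => ?_⟩
  rw [← L1norm_partialSum_sub f hnm]
  have hi : ∀ j, IntervalIntegrable (fun x => f x - partialSum f j x) volume (-π) π := fun j =>
    hf.sub ((continuous_partialSum f j).intervalIntegrable _ _)
  have h1 := L1norm_sub_le (hi n) (hi m)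
  simp only [sub_sub_sub_cancel_left] at h1
  linarith [hN n hn, hN m (hn.trans hnm)]

theorem tendsto_of_mul_log_le {f : ℝ → ℂ} (hf : IntervalIntegrable f volume (-π) π)
    (hbal : ∀ ε > 0, ∃ lam : ℝ, 1 < lam ∧ lam < 2 ∧ ∀ᶠ n : ℕ in atTop, balanceSum f lam n ≤ ε)
    (hGBV : GBV (fun n : ℕ => fhat f (n : ℤ)))
    (hlog : ∀ ε > 0, ∃ N : ℕ, ∀ n : ℕ, N ≤ n →
      ‖fhat f n‖ * Real.log n ≤ ε ∧ ‖fhat f (-n)‖ * Real.log n ≤ ε) :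
    Tendsto (fun n : ℕ => L1norm (fun x => f x - partialSum f n x)) atTop (𝓝 0) := by
  obtain ⟨K, hK, hblock⟩ := hGBV.exists_L1norm_block_le
  rw [Metric.tendsto_atTop]
  intro ε₀ hε₀
  obtain ⟨ε, hε, hεε⟩ : ∃ ε > 0, (K + 1) * ε < ε₀ :=
    ⟨ε₀ / (2 * (K + 1)), by positivity, by field_simp; linarith⟩
  obtain ⟨lam, hl1, hl2, hb⟩ := hbal ε hε
  obtain ⟨N₁, h₁⟩ := eventually_atTop.1 hb
  obtain ⟨N₂, h₂⟩ := hlog ε hε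
  -- The averaging loss is `2m` times this tolerance, at most `(λ - 1) n ε / 2` since `m ≤ 2n`, and
  -- `hgap` turns that into `(m - n) ε`.
  obtain ⟨N₃, h₃⟩ := exists_sub_mul_L1norm_sub_partialSum_le hf
    (show 0 < ε * (lam - 1) / 8 from div_pos (mul_pos hε (by linarith)) (by norm_num))
  -- With `(λ - 1) n ≥ 2`, rounding down `λn` loses at most half of the gap.
  obtain ⟨N₄, h₄⟩ := exists_nat_ge (2 / (lam - 1))
  refine ⟨N₁ + N₂ + N₃ + N₄ + 2, fun n hn => ?_⟩
  rw [Real.dist_eq, sub_zero, abs_of_nonneg (L1norm_nonneg _)]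
  obtain ⟨m, hm⟩ : ∃ m, m = ⌊lam * n⌋₊ := ⟨_, rfl⟩
  have hn0 : (0 : ℝ) < n := by exact_mod_cast (by omega : 0 < n)
  have hnm : n ≤ m := by
    rw [hm]; apply Nat.le_floor; nlinarith
  have hm2 : m ≤ 2 * n := by
    rw [hm]; apply Nat.floor_le_of_le; push_cast; nlinarith
  have hm2' : (m : ℝ) ≤ 2 * n := by exact_mod_cast hm2
  have hgap : (lam - 1) * n ≤ 2 * ((m : ℝ) - n) := by
    have a1 := Nat.lt_floor_add_one (lam * n)
    rw [← hm] at a1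
    have a2 : (N₄ : ℝ) ≤ n := by exact_mod_cast (by omega : N₄ ≤ n)
    have a3 := h₄.trans a2
    rw [div_le_iff₀ (by linarith)] at a3
    linarith
  have hgap0 : 0 < (m : ℝ) - n := by
    have := mul_pos (sub_pos.2 hl1) hn0
    linarith
  have hvp := h₃ n m (by omega) hnm
  have hsum : ∑ j ∈ Finset.Ico n m, L1norm (fun x => partialSum f j x - partialSum f n x) ≤
      ((m : ℝ) - n) * (K * ε) := by
    have : ∀ j ∈ Finset.Ico n m,
        L1norm (fun x => partialSum f j x - partialSum f n x) ≤ K * ε := fun j hj => by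
      rw [Finset.mem_Ico] at hj
      rw [L1norm_partialSum_sub f hj.1]
      refine hblock _ N₂ ε (fun n hn => (h₂ n hn).1) (fun n hn => (h₂ n hn).2) n m j (by omega)
        (by omega) hj.1 hj.2.le hm2 ?_
      rw [hm]
      exact h₁ n (by omega)
    refine (Finset.sum_le_card_nsmul _ _ _ this).trans (le_of_eq ?_)
    rw [Nat.card_Ico, nsmul_eq_mul, Nat.cast_sub hnm]
  have hsmall : 2 * (m : ℝ) * (ε * (lam - 1) / 8) ≤ ((m : ℝ) - n) * ε := by
    have b1 : 2 * (m : ℝ) * (ε * (lam - 1) / 8) ≤ 2 * (2 * n) * (ε * (lam - 1) / 8) := by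
      refine mul_le_mul_of_nonneg_right (by linarith) ?_
      exact (div_pos (mul_pos hε (by linarith)) (by norm_num)).le
    have b2 := mul_le_mul_of_nonneg_left hgap hε.le
    linarith
  have hfin : ((m : ℝ) - n) * L1norm (fun x => f x - partialSum f n x) ≤
      ((m : ℝ) - n) * ((K + 1) * ε) := by linarith
  exact (le_of_mul_le_mul_left hfin hgap0).trans_lt hεε

theorem mul_log_le_of_cauchyL1 {f : ℝ → ℂ}
    (hbal : ∀ ε > 0, ∃ lam : ℝ, 1 < lam ∧ lam < 2 ∧ ∀ᶠ n : ℕ in atTop, balanceSum f lam n ≤ ε)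
    (hGBV : GBV (fun n : ℕ => fhat f (n : ℤ)))
    (h : CauchyL1 (fun j => fhat f j) (fun j => fhat f (-j))) :
    ∀ ε > 0, ∃ N : ℕ, ∀ n : ℕ, N ≤ n →
      ‖fhat f n‖ * Real.log n ≤ ε ∧ ‖fhat f (-n)‖ * Real.log n ≤ ε := by
  intro ε hε
  obtain ⟨lam, hl1, hl2, hb⟩ := hbal (ε / 10) (by positivity)
  obtain ⟨N₁, h₁⟩ := hGBV.eventually_norm_mul_log_le h (half_pos hε)
  obtain ⟨N₂, h₂⟩ := h.eventually_norm_sub_mul_log_le hl1 hl2 (by positivity) hb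
  refine ⟨N₁ + N₂, fun n hn => ?_⟩
  have a1 := h₁ n (by omega)
  have a2 := h₂ n (by omega)
  refine ⟨a1.trans (by linarith), ?_⟩
  have a3 := norm_sub_le (fhat f n) (fhat f n - fhat f (-n))
  rw [sub_sub_cancel] at a3
  have a4 := mul_le_mul_of_nonneg_right a3 (Real.log_natCast_nonneg n)
  linarith

end L1Fourier

theorem theorem1 (f : ℝ → ℂ) (hper : Function.Periodic f (2 * π))
    (hint : IntervalIntegrable f volume (-π) π)
    (hbal : Tendsto
      (fun lam : ℝ => limsup (fun n : ℕ => ((L1Fourier.balanceSum f lam n : ℝ) : EReal)) atTop)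
      (𝓝[>] (1 : ℝ)) (𝓝 (0 : EReal)))
    (hGBV : L1Fourier.GBV (fun n : ℕ => L1Fourier.fhat f (n : ℤ))) :
    Tendsto (fun n : ℕ => L1Fourier.L1norm (fun x => f x - L1Fourier.partialSum f n x))
        atTop (𝓝 0) ↔
      Tendsto (fun n : ℤ => L1Fourier.fhat f n * ((Real.log |(n : ℝ)| : ℝ) : ℂ))
        cofinite (𝓝 0) := by
  have hb := fun ε (hε : ε > 0) => L1Fourier.exists_eventually_balanceSum_le hbal hε
  rw [L1Fourier.tendsto_fhat_mul_log_iff]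
  exact ⟨fun h => L1Fourier.mul_log_le_of_cauchyL1 hb hGBV
      (L1Fourier.cauchyL1_of_tendsto hint h),
    fun h => L1Fourier.tendsto_of_mul_log_le hint hb hGBV h⟩
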